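/- Let $W$ be a standard Wiener process relative to a filtration $(\mathcal F_t)_{t\ge 0}$. Let $a,c\in C([0,\infty))$ with $c(0)\neq 0$, let $\sigma\in C^1([0,\infty))$ be positive, let $A,B\in\mathbb R$, and let $m>0$ be rational. Powers $x^m$ of a real number $x$ are the usual real powers if $m$ has odd denominator (even in $x$ if the numerator is even, odd in $x$ if it is odd), and the signed powers $|x|^{m-1}x$ if the denominator is even; $x^{1/m}$ denotes $\operatorname{sgn}(x)|x|^{1/m}$. Let $(R_t,p_t)_{t\ge0}$ be an adapted solution with continuous paths of $$dR_t=c(t)\,p_t^{\,m}\,dt,\qquad dp_t=a(t)\,p_t\,dt+\sigma(t)\,dW_t,\qquad R_0=A,\quad R'_0=B,$$ where, if the numerator of $m$ is even, $p_0\ge 0$ is assumed; so $p_0=c_1:=(B/c(0))^{1/m}$. **Pathwise formula.** Put $q(s)=\sigma'(s)/\sigma(s)-a(s)$. Almost surely, for all $t\ge 0$, $$R_t=A+\int_0^t\Big[e^{-\int_0^u q(s)\,ds}\Big(\tfrac12\int_0^u e^{\int_0^s q(v)\,dv}\big(1-q(s)(2W_s-s)\big)\,ds+\frac{c_1}{\sigma(0)}\Big)+W_u-\frac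 u2\Big]^m\sigma(u)^m\,c(u)\,du .$$ For the rest let $m\ge1$ be an integer, $a\equiv0$ and $\sigma(t)\equiv\sigma>0$ constant. **Case $B=0$.** For every $t\ge0$, $R_t$ is square integrable. Put $L(m;c)=\frac{m!}{2^{m/2}(m/2)!}\int_0^t c(u)u^{m/2}\,du$ if $m$ is even and $L(m;c)=0$ if $m$ is odd. Then $E[R_t]=A+\sigma^mL(m;c)$ if $m$ is even, $E[R_t]=A$ if $m$ is odd, and $$\operatorname{Var}[R_t]=\sigma^{2m}\Big[\int_0^t\!\int_0^t c(s)c(u)\,\mathcal E_m(s,u)\,ds\,du-L(m;c)^2\Big],$$ where, with $\rho=\min(s,u)/\sqrt{su}$, $$\mathcal E_m(s,u)=(su)^{m/2}\,\frac{(m!)^2}{2^m}\sum_{j=0}^{m/2}\frac{(2\rho)^{2j}}{(2j)!\,[(\frac m2-j)!]^2}\quad(m\text{ even}),$$ $$\mathcal E_m(s,u)=(su)^{m/2}\,\frac{(m!)^2}{2^m}\sum_{j=0}^{(m-1)/2}\frac{(2\rho)^{2j+1}}{(2j+1)!\,[(\frac{m-1}2-j)!]^2}\quad(m\text{ odd}).$$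 **Case $B\ne0$.** For every $t\ge0$, $R_t$ is square integrable and $$E[R_t]=A+\sigma^m\sum_{j=0}^{\lfloor m/2\rfloor}\binom m{m-2j}\Big(\frac{c_1}\sigma\Big)^{m-2j}\frac{(2j)!}{2^jj!}\int_0^tc(u)u^j\,du .$$ Moreover, let $$T_t=A+\int_0^tc(u)\big[c_1^m+m\,c_1^{m-1}\sigma W_u\big]du$$ be the process obtained from $R_t=A+\int_0^tc(u)(c_1+\sigma W_u)^m\,du$ by first-order Taylor expansion of the integrand, and let $V_t=m^2\sigma^2c_1^{2m-2}\int_0^t\!\int_0^tc(u)c(s)\min(u,s)\,du\,ds$. Then $T_t$ is square integrable, $$E[T_t^2]=A^2+2A\,c_1^m\int_0^tc(u)\,du+c_1^{2m}\Big(\int_0^tc(u)\,du\Big)^2+V_t,\qquad \operatorname{Var}[T_t]=V_t,$$ and $\operatorname{Var}[R_t]\approx V_t$ in the following sense: for all $\sigma_0,T>0$ there is a constant $K$ depending only on $m,B,c,\sigma_0,T$ such that for all $A\in\mathbb R$, $0<\sigma\le\sigma_0$ and $0\le t\le T$, $$E[(R_t-T_t)^2]\le K\sigma^4,\qquad |\operatorname{Var}[R_t]-V_t|\le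 K\sigma^4 .$$ -/

import Mathlib

open MeasureTheory ProbabilityTheory Filter Set
open scoped NNReal ENNReal Nat Topology

universe v

noncomputable section

namespace InterestRate

/-- The power `x ^ q` of a real number with rational exponent. If `q` has odd denominator this is the
usual real power (an even function of `x` if the numerator is even, an odd one if it is odd);
if the denominator is even it is the signed power `|x| ^ (q - 1) * x`. -/
def ratPow (x : ℝ) (q : ℚ) : ℝ :=
  if Even q.num then |x| ^ (q : ℝ) else Real.sign x * |x| ^ (q : ℝ)

/-- The root `x ^ (1 / m)`: the signed root, which is the usual `m`-th root for `0 ≤ x`, and the only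
solution `y` of `ratPow y m = x` if the numerator of `m > 0` is odd. -/
def ratRoot (x : ℝ) (m : ℚ) : ℝ :=
  Real.sign x * |x| ^ ((1 : ℝ) / (m : ℝ))

section Paths

variable {Ω : Type*} {mΩ : MeasurableSpace Ω}

/-- `W` is a standard Wiener process relative to the filtration `𝓕`. -/
structure IsWiener (𝓕 : Filtration ℝ≥0 mΩ) (W : ℝ≥0 → Ω → ℝ) (P : Measure Ω) : Prop where
  brownian : IsBrownianReal W P
  adapted : StronglyAdapted 𝓕 W
  indep : ∀ s t : ℝ≥0, s ≤ t →
    Indep (MeasurableSpace.comap (fun ω => W t ω - W s ω) inferInstance) (𝓕 s) P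

/-- `I` is the Itô integral `∫₀ᵗ H dW` of the adapted integrand `H` with continuous paths:
the limit in probability of the left-endpoint Riemann sums. -/
structure IsItoIntegral (𝓕 : Filtration ℝ≥0 mΩ) (W : ℝ≥0 → Ω → ℝ) (P : Measure Ω)
    (H : ℝ≥0 → Ω → ℝ) (t : ℝ≥0) (I : Ω → ℝ) : Prop where
  adapted : StronglyAdapted 𝓕 H
  cont : ∀ᵐ ω ∂P, Continuous (fun s => H s ω)
  tendsto : TendstoInMeasure P
    (fun (N : ℕ) (ω : Ω) => ∑ i ∈ Finset.range N,
      H ((i : ℝ≥0) * t / N) ω * (W (((i : ℝ≥0) + 1) * t / N) ω - W ((i : ℝ≥0) * t / N) ω))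
    atTop I

/-- `(r, p)` solves, on `[0, ∞)`,
`dr = c(t) p ^ m dt`, `dp = (a(t) p ^ l + b(t) r ^ n) dt + σ(t) r ^ k dW`. -/
structure IsSolution (𝓕 : Filtration ℝ≥0 mΩ) (W : ℝ≥0 → Ω → ℝ) (P : Measure Ω)
    (m n k l : ℚ) (a b c σ : ℝ → ℝ) (r p : ℝ≥0 → Ω → ℝ) : Prop where
  adapted_r : StronglyAdapted 𝓕 r
  adapted_p : StronglyAdapted 𝓕 p
  cont_r : ∀ᵐ ω ∂P, Continuous (fun t => r t ω)
  cont_p : ∀ᵐ ω ∂P, Continuous (fun t => p t ω)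
  integrable_r : ∀ᵐ ω ∂P, ∀ t : ℝ≥0,
    IntervalIntegrable (fun s : ℝ => c s * ratPow (p s.toNNReal ω) m) volume 0 t
  integrable_p : ∀ᵐ ω ∂P, ∀ t : ℝ≥0,
    IntervalIntegrable (fun s : ℝ => a s * ratPow (p s.toNNReal ω) l
      + b s * ratPow (r s.toNNReal ω) n) volume 0 t
  eq_r : ∀ᵐ ω ∂P, ∀ t : ℝ≥0,
    r t ω = r 0 ω + ∫ s in (0 : ℝ)..t, c s * ratPow (p s.toNNReal ω) m
  eq_p : ∀ t : ℝ≥0, IsItoIntegral 𝓕 W P (fun s ω => σ s * ratPow (r s ω) k) t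
    (fun ω => p t ω - p 0 ω - ∫ s in (0 : ℝ)..t,
      (a s * ratPow (p s.toNNReal ω) l + b s * ratPow (r s.toNNReal ω) n))

/-- `(R, p)` solves the system above with `R₀ = A` and `R'₀ = B`. As `R'₀ = c(0) p₀ ^ m`, the datum
`B` fixes `p₀` only up to its sign if the numerator of `m` is even; then the nonnegative root is
taken, so that `p₀ = (B / c(0)) ^ (1 / m)` in all cases. -/
structure IsCauchySolution (𝓕 : Filtration ℝ≥0 mΩ) (W : ℝ≥0 → Ω → ℝ) (P : Measure Ω)
    (m n k l : ℚ) (a b c σ : ℝ → ℝ) (A B : ℝ) (R p : ℝ≥0 → Ω → ℝ) : Prop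
    extends IsSolution 𝓕 W P m n k l a b c σ R p where
  init : ∀ᵐ ω ∂P, R 0 ω = A
  init_deriv : ∀ᵐ ω ∂P, HasDerivWithinAt (fun t : ℝ => R t.toNNReal ω) B (Ici 0) 0
  root : Even m.num → ∀ᵐ ω ∂P, 0 ≤ p 0 ω

end Paths

/-- `σ'(s) / σ(s) - a(s)`. -/
def rate (a σ : ℝ → ℝ) (s : ℝ) : ℝ :=
  derivWithin σ (Ici 0) s / σ s - a s

/-- The explicit formula, at time `t`, along the path `w` of the Wiener process. -/
def explicitSolution (m : ℚ) (a c σ : ℝ → ℝ) (A B : ℝ) (w : ℝ≥0 → ℝ) (t : ℝ) : ℝ :=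
  A + ∫ u in (0 : ℝ)..t,
    ratPow
      (Real.exp (-∫ s in (0 : ℝ)..u, rate a σ s) *
          (1 / 2 * (∫ s in (0 : ℝ)..u, Real.exp (∫ v in (0 : ℝ)..s, rate a σ v) *
              (1 + (-(derivWithin σ (Ici 0) s / σ s) + a s) * (2 * w s.toNNReal - s)))
            + ratRoot (B / c 0) m * (σ 0)⁻¹)
        + w u.toNNReal - u / 2) m
      * ratPow (σ u) m * c u

/-- `L(m; c)` at time `t`; it vanishes for odd `m`. -/
def meanShift (m : ℕ) (c : ℝ → ℝ) (t : ℝ) : ℝ :=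
  if Even m then
    (m ! : ℝ) / (2 ^ (m / 2) * ((m / 2)! : ℝ)) * ∫ u in (0 : ℝ)..t, c u * u ^ (m / 2)
  else 0

/-- The mixed-moment kernel `𝓔ₘ(s, u)`. -/
def mixedKernel (m : ℕ) (s u : ℝ) : ℝ :=
  if Even m then
    Real.sqrt (s * u) ^ m * ((m ! : ℝ) ^ 2 / 2 ^ m) *
      ∑ j ∈ Finset.range (m / 2 + 1),
        (2 * (min s u / Real.sqrt (s * u))) ^ (2 * j)
          / (((2 * j)! : ℝ) * ((m / 2 - j)! : ℝ) ^ 2)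
  else
    Real.sqrt (s * u) ^ m * ((m ! : ℝ) ^ 2 / 2 ^ m) *
      ∑ j ∈ Finset.range ((m - 1) / 2 + 1),
        (2 * (min s u / Real.sqrt (s * u))) ^ (2 * j + 1)
          / (((2 * j + 1)! : ℝ) * (((m - 1) / 2 - j)! : ℝ) ^ 2)

/-- The process obtained from `A + ∫₀ᵗ c(u) (c₁ + σ W_u) ^ m du` by replacing the power with its
first-order Taylor polynomial at `c₁`. -/
def taylorProcess {Ω : Type*} (m : ℕ) (c : ℝ → ℝ) (A c₁ σ : ℝ) (W : ℝ≥0 → Ω → ℝ)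
    (t : ℝ) (ω : Ω) : ℝ :=
  A + ∫ u in (0 : ℝ)..t, c u * (c₁ ^ m + m * c₁ ^ (m - 1) * (σ * W u.toNNReal ω))

end InterestRate

end

open InterestRate

/-!
Since the diffusion coefficient is deterministic and `C¹`, summation by parts in the Riemann sums
gives `∫ σ dW = σ(t) W_t - ∫ σ' W ds`, so that along each path `p` satisfies a linear Volterra
equation, which an integrating factor solves explicitly.

For constant `σ` and `a = 0` this reads `p = c₁ + σ W`, so `R` is a polynomial in `σ` whose
coefficients are multiples of the integrals `Z_k = ∫₀ᵗ c(u) W_u ^ k du`, with means and covariances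
given by Wick's formula; the latter follows from Gaussian integration by parts. In the variance
estimate the term of order `σ³` is a multiple of `cov(Z₁, Z₂)`, an odd Gaussian moment, hence zero.
-/

namespace InterestRate

lemma integral_id_mul_gaussianReal {s : ℝ≥0} {f f' : ℝ → ℝ} (hf : ∀ x, HasDerivAt f (f' x) x)
    (hfi : Integrable f (gaussianReal 0 s)) (hfi' : Integrable f' (gaussianReal 0 s))
    (hxf : Integrable (fun x => x * f x) (gaussianReal 0 s)) :
    ∫ x, x * f x ∂(gaussianReal 0 s) = s * ∫ x, f' x ∂(gaussianReal 0 s) := by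
  rcases eq_or_ne s 0 with rfl | hs
  · simp [gaussianReal_zero_var]
  have integrable_pdf_mul {g : ℝ → ℝ} (hg : Integrable g (gaussianReal 0 s)) :
      Integrable (fun x => gaussianPDFReal 0 s x * g x) := by
    rw [gaussianReal_of_var_ne_zero _ hs, integrable_withDensity_iff_integrable_smul'
      (measurable_gaussianPDF 0 s) (ae_of_all _ fun _ => gaussianPDF_lt_top)] at hg
    simpa only [toReal_gaussianPDF, smul_eq_mul] using hg
  have hpdf (x : ℝ) : HasDerivAt (gaussianPDFReal 0 s) (-(x / s) * gaussianPDFReal 0 s x) x := by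
    have hexp : HasDerivAt (fun x : ℝ => -(x - 0) ^ 2 / (2 * s)) (-(x / s)) x :=
      (((hasDerivAt_id' x).sub_const 0).fun_pow 2).fun_neg.div_const (2 * (s : ℝ))
        |>.congr_deriv (by simp; ring)
    exact (hexp.exp.const_mul (√(2 * Real.pi * s))⁻¹).congr_deriv (by rw [gaussianPDFReal]; ring)
  have parts := integral_mul_deriv_eq_deriv_mul_of_integrable (fun x _ => hf x) (fun x _ => hpdf x)
    (by convert (integrable_pdf_mul hxf).const_mul (-(s : ℝ)⁻¹) using 2; simp; ring)
    (by convert integrable_pdf_mul hfi' using 2; simp; ring)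
    (by convert integrable_pdf_mul hfi using 2; simp; ring)
  rw [integral_gaussianReal_eq_integral_smul hs, integral_gaussianReal_eq_integral_smul hs]
  calc ∫ x, gaussianPDFReal 0 s x • (x * f x)
      = -s * ∫ x, f x * (-(x / s) * gaussianPDFReal 0 s x) := by
        rw [← integral_const_mul]
        congr 1 with x
        have : (s : ℝ) ≠ 0 := mod_cast hs
        simp only [smul_eq_mul]; field_simp
    _ = s * ∫ x, gaussianPDFReal 0 s x • f' x := by
        rw [parts]; simp [mul_comm]

/-- The `n`-th moment of the centred Gaussian law of variance `s`, in closed form. -/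
noncomputable def gaussianMoment (s : ℝ) (n : ℕ) : ℝ :=
  if Even n then (n ! : ℝ) / (2 ^ (n / 2) * ((n / 2)! : ℝ)) * s ^ (n / 2) else 0

@[simp]
lemma gaussianMoment_zero (s : ℝ) : gaussianMoment s 0 = 1 := by simp [gaussianMoment]

lemma gaussianMoment_of_odd (s : ℝ) {n : ℕ} (hn : Odd n) : gaussianMoment s n = 0 :=
  if_neg (Nat.not_even_iff_odd.2 hn)

lemma gaussianMoment_two_mul (s : ℝ) (k : ℕ) :
    gaussianMoment s (2 * k) = ((2 * k)! : ℝ) / (2 ^ k * (k ! : ℝ)) * s ^ k := by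
  simp [gaussianMoment]

lemma gaussianMoment_add_two (s : ℝ) (n : ℕ) :
    gaussianMoment s (n + 2) = s * (n + 1) * gaussianMoment s n := by
  rcases Nat.even_or_odd' n with ⟨k, rfl | rfl⟩
  · rw [show 2 * k + 2 = 2 * (k + 1) by ring, gaussianMoment_two_mul, gaussianMoment_two_mul,
      Nat.factorial_succ k, mul_add_one, Nat.factorial_succ, Nat.factorial_succ]
    push_cast
    field_simp
    ring
  · rw [gaussianMoment_of_odd s (by simp [parity_simps]), gaussianMoment_of_odd s (by simp),
      mul_zero]

lemma gaussianMoment_succ (s : ℝ) (n : ℕ) :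
    gaussianMoment s (n + 1) = s * n * gaussianMoment s (n - 1) := by
  rcases n with _ | n
  · simp [gaussianMoment_of_odd]
  · simp [gaussianMoment_add_two]

section HasLaw

variable {Ω : Type*} {mΩ : MeasurableSpace Ω} {P : Measure Ω} {X : Ω → ℝ} {s : ℝ≥0}

lemma memLp_two_pow_of_hasLaw (hX : HasLaw X (gaussianReal 0 s) P) (n : ℕ) :
    MemLp (fun ω => X ω ^ n) 2 P := by
  have hid : Integrable (fun x : ℝ => (x ^ n) ^ 2) (gaussianReal 0 s) := by
    have := (memLp_id_gaussianReal (μ := 0) (v := s) (n * 2 : ℕ)).integrable_norm_pow'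
    refine this.congr (ae_of_all _ fun x => ?_)
    simp only [id_eq, Real.norm_eq_abs, pow_mul, ← abs_pow, abs_sq]
  rw [memLp_two_iff_integrable_sq (hX.aemeasurable.pow_const n).aestronglyMeasurable]
  rw [← hX.map_eq] at hid
  exact hid.comp_aemeasurable hX.aemeasurable

lemma integrable_pow_of_hasLaw (hX : HasLaw X (gaussianReal 0 s) P) (n : ℕ) :
    Integrable (fun ω => X ω ^ n) P := by
  have := hX.isProbabilityMeasure
  exact (memLp_two_pow_of_hasLaw hX n).integrable one_le_two

lemma integral_pow_gaussianReal (s : ℝ≥0) (n : ℕ) :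
    ∫ x, x ^ n ∂(gaussianReal 0 s) = gaussianMoment s n := by
  have integrable_pow (n : ℕ) := integrable_pow_of_hasLaw (HasLaw.id (μ := gaussianReal 0 s)) n
  induction n using Nat.twoStepInduction with
  | zero => simp
  | one => simp [gaussianMoment_of_odd]
  | more n ih _ =>
    have stein := integral_id_mul_gaussianReal (s := s) (fun x => hasDerivAt_pow (n + 1) x)
      (integrable_pow _) ((integrable_pow n).const_mul _)
      (by simpa only [id, ← pow_succ'] using integrable_pow (n + 2))
    simp only [← pow_succ', integral_const_mul, Nat.add_sub_cancel] at stein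
    rw [stein, ih, gaussianMoment_add_two]
    push_cast; ring

lemma integral_pow_of_hasLaw (hX : HasLaw X (gaussianReal 0 s) P) (n : ℕ) :
    ∫ ω, X ω ^ n ∂P = gaussianMoment s n := by
  rw [← integral_pow_gaussianReal]
  exact hX.integral_comp (f := fun x => x ^ n) (by fun_prop)

end HasLaw

/-- Wick's formula for the mixed moment `E[X ^ a * Z ^ b]` of a centred Gaussian pair `(X, Z)` with
`Var X = s`, `Var Z = u` and `Cov (X, Z) = r`; the summand at `(j, a - j)` collects the pairings
which match exactly `j` of the `X` with a `Z`. -/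
noncomputable def jointGaussianMoment (s r u : ℝ) (a b : ℕ) : ℝ :=
  ∑ ji ∈ Finset.HasAntidiagonal.antidiagonal a, (a.choose ji.1 : ℝ) *
    (b.choose ji.1 * ji.1 ! * r ^ ji.1 * gaussianMoment s ji.2 * gaussianMoment u (b - ji.1))

@[simp]
lemma jointGaussianMoment_zero_left (s r u : ℝ) (b : ℕ) :
    jointGaussianMoment s r u 0 b = gaussianMoment u b := by
  simp [jointGaussianMoment]

lemma jointGaussianMoment_one_one (s r u : ℝ) : jointGaussianMoment s r u 1 1 = r := by
  simp [jointGaussianMoment, Finset.Nat.antidiagonal_succ, gaussianMoment_of_odd]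

lemma jointGaussianMoment_of_odd (s r u : ℝ) {a b : ℕ} (hab : Odd (a + b)) :
    jointGaussianMoment s r u a b = 0 := by
  refine Finset.sum_eq_zero fun ⟨j, i⟩ hji => ?_
  rw [Finset.HasAntidiagonal.mem_antidiagonal] at hji
  rcases lt_or_ge b j with hbj | hbj
  · simp [Nat.choose_eq_zero_of_lt hbj]
  obtain h | h : Odd i ∨ Odd (b - j) := by grind
  · simp [gaussianMoment_of_odd s h]
  · simp [gaussianMoment_of_odd u h]

lemma jointGaussianMoment_succ (s r u : ℝ) (a b : ℕ) :
    jointGaussianMoment s r u (a + 1) b = s * a * jointGaussianMoment s r u (a - 1) b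
      + r * b * jointGaussianMoment s r u a (b - 1) := by
  rw [jointGaussianMoment, Finset.sum_antidiagonal_choose_succ_mul (fun j i => (b.choose j : ℝ) *
    j ! * r ^ j * gaussianMoment s i * gaussianMoment u (b - j))]
  congr 1
  · rcases a with _ | a
    · simp [gaussianMoment_of_odd]
    rw [Finset.Nat.sum_antidiagonal_succ', jointGaussianMoment, Finset.mul_sum]
    simp only [gaussianMoment_succ, Nat.cast_zero, mul_zero, zero_mul, zero_add,
      Nat.add_sub_cancel]
    refine Finset.sum_congr rfl fun ⟨j, i⟩ hji => ?_
    obtain rfl : j + i = a := Finset.HasAntidiagonal.mem_antidiagonal.1 hji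
    have absorb : ((j + i + 1).choose j : ℝ) * (i + 1) = (j + i).choose j * (j + i + 1) := by
      have := Nat.choose_mul_succ_eq (j + i) j
      rw [show j + i + 1 - j = i + 1 by omega] at this
      exact_mod_cast this.symm
    push_cast
    linear_combination (s * (b.choose j * j ! * r ^ j * gaussianMoment s i *
      gaussianMoment u (b - j))) * absorb
  · rw [jointGaussianMoment, Finset.mul_sum]
    refine Finset.sum_congr rfl fun ⟨j, i⟩ hji => ?_
    obtain rfl : j + i = a := Finset.HasAntidiagonal.mem_antidiagonal.1 hji
    rcases b with _ | b
    · simp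
    have absorb : ((b + 1).choose (j + 1) : ℝ) * (j + 1) = (b + 1) * b.choose j := by
      exact_mod_cast (Nat.add_one_mul_choose_eq b j).symm
    simp only [Nat.factorial_succ, Nat.add_sub_add_right, Nat.add_sub_cancel, pow_succ]
    push_cast
    rw [Nat.choose_symm_add]
    linear_combination ((j + i).choose i * j ! * r ^ j * r * gaussianMoment s i *
      gaussianMoment u (b - j)) * absorb

section IndepFun

variable {Ω 𝓨 : Type*} {mΩ : MeasurableSpace Ω} {m𝓨 : MeasurableSpace 𝓨} {P : Measure Ω}
  {X : Ω → ℝ} {s : ℝ≥0}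

lemma integral_mul_of_indepFun {Y : Ω → 𝓨} (hX : HasLaw X (gaussianReal 0 s) P)
    (hY : AEMeasurable Y P) (hXY : IndepFun X Y P) {f f' : ℝ → 𝓨 → ℝ}
    (hff' : ∀ x y, HasDerivAt (f · y) (f' x y) x)
    (hfm : Measurable (Function.uncurry f)) (hfm' : Measurable (Function.uncurry f'))
    (hf : Integrable (fun ω => f (X ω) (Y ω)) P) (hf' : Integrable (fun ω => f' (X ω) (Y ω)) P)
    (hXf : Integrable (fun ω => X ω * f (X ω) (Y ω)) P) :
    ∫ ω, X ω * f (X ω) (Y ω) ∂P = s * ∫ ω, f' (X ω) (Y ω) ∂P := by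
  have := hX.isProbabilityMeasure
  have := Measure.isProbabilityMeasure_map hY (μ := P)
  have hlaw : HasLaw (fun ω => (X ω, Y ω)) ((gaussianReal 0 s).prod (P.map Y)) P :=
    (indepFun_iff_hasLaw_prodMk_prod hX ⟨hY, rfl⟩).1 hXY
  have integrable_prod {g : ℝ → 𝓨 → ℝ} (hgm : Measurable (Function.uncurry g))
      (hg : Integrable (fun ω => g (X ω) (Y ω)) P) :
      Integrable (Function.uncurry g) ((gaussianReal 0 s).prod (P.map Y)) := by
    rw [← hlaw.map_eq, integrable_map_measure hgm.aestronglyMeasurable hlaw.aemeasurable]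
    exact hg
  have integral_prod {g : ℝ → 𝓨 → ℝ} (hgm : Measurable (Function.uncurry g))
      (hg : Integrable (fun ω => g (X ω) (Y ω)) P) :
      ∫ ω, g (X ω) (Y ω) ∂P = ∫ y, ∫ x, g x y ∂(gaussianReal 0 s) ∂(P.map Y) :=
    (hlaw.integral_comp hgm.aestronglyMeasurable).trans
      (integral_prod_symm _ (integrable_prod hgm hg))
  have hXfm : Measurable (Function.uncurry fun x y => x * f x y) := measurable_fst.mul hfm
  rw [integral_prod hXfm hXf, integral_prod hfm' hf', ← integral_const_mul]
  refine integral_congr_ae ?_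
  filter_upwards [(integrable_prod hfm hf).prod_left_ae, (integrable_prod hfm' hf').prod_left_ae,
    (integrable_prod hXfm hXf).prod_left_ae] with y hy hy' hxy
  exact integral_id_mul_gaussianReal (hff' · y) hy hy' hxy

variable {Y : Ω → ℝ} {v : ℝ≥0}

lemma integral_pow_succ_mul_add_pow (hX : HasLaw X (gaussianReal 0 s) P)
    (hY : HasLaw Y (gaussianReal 0 v) P) (hXY : IndepFun X Y P) (a b : ℕ) :
    ∫ ω, X ω ^ (a + 1) * (X ω + Y ω) ^ b ∂P
      = s * a * ∫ ω, X ω ^ (a - 1) * (X ω + Y ω) ^ b ∂P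
        + s * b * ∫ ω, X ω ^ a * (X ω + Y ω) ^ (b - 1) ∂P := by
  have hZ : HasLaw (fun ω => X ω + Y ω) (gaussianReal 0 (s + v)) P := by
    simpa [gaussianReal_conv_gaussianReal] using hXY.hasLaw_fun_add hX hY
  have hint (k l : ℕ) : Integrable (fun ω => X ω ^ k * (X ω + Y ω) ^ l) P :=
    (memLp_two_pow_of_hasLaw hX k).integrable_mul (memLp_two_pow_of_hasLaw hZ l)
  have hderiv (x y : ℝ) : HasDerivAt (fun x => x ^ a * (x + y) ^ b)
      (a * (x ^ (a - 1) * (x + y) ^ b) + b * (x ^ a * (x + y) ^ (b - 1))) x :=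
    ((hasDerivAt_pow a x).fun_mul (((hasDerivAt_id' x).add_const y).fun_pow b)).congr_deriv
      (by ring)
  have stein := integral_mul_of_indepFun hX hY.aemeasurable hXY hderiv (by fun_prop) (by fun_prop)
    (hint a b) (((hint (a - 1) b).const_mul _).add ((hint a (b - 1)).const_mul _))
    (by simpa only [pow_succ', mul_assoc] using hint (a + 1) b)
  rw [integral_add ((hint _ _).const_mul _) ((hint _ _).const_mul _), integral_const_mul,
    integral_const_mul] at stein
  simp only [pow_succ', mul_assoc] at stein ⊢
  rw [stein, mul_add]

lemma integral_pow_mul_add_pow (hX : HasLaw X (gaussianReal 0 s) P)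
    (hY : HasLaw Y (gaussianReal 0 v) P) (hXY : IndepFun X Y P) (a b : ℕ) :
    ∫ ω, X ω ^ a * (X ω + Y ω) ^ b ∂P = jointGaussianMoment s s (s + v) a b := by
  induction a using Nat.strong_induction_on generalizing b with
  | _ a ih =>
    rcases a with _ | a
    · have hZ : HasLaw (fun ω => X ω + Y ω) (gaussianReal 0 (s + v)) P := by
        simpa [gaussianReal_conv_gaussianReal] using hXY.hasLaw_fun_add hX hY
      simpa using integral_pow_of_hasLaw hZ b
    · rw [integral_pow_succ_mul_add_pow hX hY hXY, jointGaussianMoment_succ, ih (a - 1) (by lia),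
        ih a (by lia)]

end IndepFun

lemma sum_range_eq_sum_range_of_mod_two {r m : ℕ} (hrm : r ≤ m) {f : ℕ → ℝ}
    (hf : ∀ k, k % 2 ≠ r → f k = 0) :
    ∑ k ∈ Finset.range (m + 1), f k = ∑ j ∈ Finset.range ((m - r) / 2 + 1), f (2 * j + r) := by
  symm
  refine Finset.sum_of_injOn (2 * · + r) (fun i _ j _ hij => by grind) (fun j hj => ?_)
    (fun k hk hkr => hf k fun hmod => hkr ⟨k / 2, ?_, ?_⟩) (fun _ _ => rfl)
  · simp at hj ⊢; lia
  · simp at hk ⊢; lia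
  · simp; lia

lemma mixedKernel_eq (m : ℕ) (s u : ℝ) :
    mixedKernel m s u = √(s * u) ^ m * ((m ! : ℝ) ^ 2 / 2 ^ m) *
      ∑ j ∈ Finset.range ((m - m % 2) / 2 + 1), (2 * (min s u / √(s * u))) ^ (2 * j + m % 2) /
        (((2 * j + m % 2)! : ℝ) * (((m - m % 2) / 2 - j)! : ℝ) ^ 2) := by
  rcases Nat.mod_two_eq_zero_or_one m with h | h
  · rw [mixedKernel, if_pos (Nat.even_iff.2 h), h]; rfl
  · rw [mixedKernel, if_neg (Nat.not_even_iff.2 h), h]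

lemma mixedKernel_eq_jointGaussianMoment (m : ℕ) {s u : ℝ} (hs : 0 < s) (hu : 0 < u) :
    mixedKernel m s u = jointGaussianMoment s (min s u) u m m := by
  rw [jointGaussianMoment, Finset.Nat.sum_antidiagonal_eq_sum_range_succ (fun j i =>
    (m.choose j : ℝ) *
      (m.choose j * j ! * min s u ^ j * gaussianMoment s i * gaussianMoment u (m - j))),
    mixedKernel_eq, sum_range_eq_sum_range_of_mod_two (Nat.mod_le m 2) fun k hk => ?odd,
    Finset.mul_sum]
  case odd =>
    rcases lt_or_ge m k with hmk | hkm
    · simp [Nat.choose_eq_zero_of_lt hmk]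
    · simp [gaussianMoment_of_odd s (n := m - k) (by grind)]
  refine Finset.sum_congr rfl fun j hj => ?_
  obtain ⟨i, hi⟩ : ∃ i, m = 2 * i + (2 * j + m % 2) :=
    ⟨(m - m % 2) / 2 - j, by have := Finset.mem_range.1 hj; lia⟩
  rw [show (m - m % 2) / 2 - j = i by lia]
  generalize 2 * j + m % 2 = k at hi
  subst hi
  have : √(s * u) ≠ 0 := (Real.sqrt_pos.2 (mul_pos hs hu)).ne'
  have hq2 : √(s * u) ^ 2 = s * u := Real.sq_sqrt (mul_pos hs hu).le
  rw [Nat.add_sub_cancel, gaussianMoment_two_mul, gaussianMoment_two_mul,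
    Nat.cast_choose ℝ (Nat.le_add_left k (2 * i)), Nat.add_sub_cancel, mul_pow 2, div_pow,
    pow_add √(s * u), pow_mul √(s * u), hq2, pow_add (2 : ℝ) (2 * i), pow_mul (2 : ℝ) 2,
    show (2 : ℝ) ^ 2 = 2 * 2 by norm_num, mul_pow 2 2]
  field_simp
  ring

lemma mixedKernel_comm (m : ℕ) (s u : ℝ) : mixedKernel m s u = mixedKernel m u s := by
  simp only [mixedKernel, mul_comm s u, min_comm s u]

section ParametricIntegral

variable {α β Ω : Type*} {mα : MeasurableSpace α} {mβ : MeasurableSpace β}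
  {mΩ : MeasurableSpace Ω} {μ : Measure α} {ν : Measure β} {P : Measure Ω}
  [IsFiniteMeasure μ] [IsFiniteMeasure ν] [IsFiniteMeasure P] {f : α → Ω → ℝ} {g : β → Ω → ℝ}

lemma sq_integral_le {h : α → ℝ} (hh : MemLp h 2 μ) :
    (∫ x, h x ∂μ) ^ 2 ≤ μ.real univ * ∫ x, h x ^ 2 ∂μ := by
  rcases eq_zero_or_neZero μ with rfl | _
  · simp
  have jensen := (even_two.convexOn_pow (𝕜 := ℝ)).map_average_le (by fun_prop) isClosed_univ
    (by simp) (hh.integrable one_le_two) hh.integrable_sq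
  have hpos : 0 < μ.real univ := measureReal_univ_pos
  simp only [average_eq, smul_eq_mul, mul_pow] at jensen
  calc (∫ x, h x ∂μ) ^ 2
      = μ.real univ ^ 2 * ((μ.real univ)⁻¹ ^ 2 * (∫ x, h x ∂μ) ^ 2) := by field_simp
    _ ≤ μ.real univ ^ 2 * ((μ.real univ)⁻¹ * ∫ x, h x ^ 2 ∂μ) := by gcongr
    _ = μ.real univ * ∫ x, h x ^ 2 ∂μ := by field_simp

lemma integrable_uncurry_mul_uncurry (hf : MemLp f.uncurry 2 (μ.prod P))
    (hg : MemLp g.uncurry 2 (ν.prod P)) :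
    Integrable (fun z : (α × β) × Ω => f z.1.1 z.2 * g z.1.2 z.2) ((μ.prod ν).prod P) := by
  have hswap : MeasurePreserving (Prod.map Prod.swap id) ((μ.prod ν).prod P)
      ((ν.prod μ).prod P) := Measure.measurePreserving_swap.prod (.id P)
  have hf' := (hf.comp_snd ν).comp_measurePreserving
    ((measurePreserving_prodAssoc ν μ P).comp hswap)
  have hg' := (hg.comp_snd μ).comp_measurePreserving (measurePreserving_prodAssoc μ ν P)
  exact hf'.integrable_mul hg'

lemma integrable_integral_mul_integral (hf : MemLp f.uncurry 2 (μ.prod P))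
    (hg : MemLp g.uncurry 2 (ν.prod P)) :
    Integrable (fun ω => (∫ x, f x ω ∂μ) * ∫ y, g y ω ∂ν) P := by
  simp only [← integral_prod_mul]
  exact (integrable_uncurry_mul_uncurry hf hg).integral_prod_right

lemma integral_integral_mul_integral (hf : MemLp f.uncurry 2 (μ.prod P))
    (hg : MemLp g.uncurry 2 (ν.prod P)) :
    ∫ ω, (∫ x, f x ω ∂μ) * (∫ y, g y ω ∂ν) ∂P = ∫ x, ∫ y, ∫ ω, f x ω * g y ω ∂P ∂ν ∂μ := by
  have h := integrable_uncurry_mul_uncurry hf hg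
  simp only [← integral_prod_mul]
  rw [← integral_prod_symm _ h, integral_prod _ h, integral_prod _ h.integral_prod_left]

lemma memLp_integral (hf : MemLp f.uncurry 2 (μ.prod P)) :
    MemLp (fun ω => ∫ x, f x ω ∂μ) 2 P := by
  refine (memLp_two_iff_integrable_sq ?_).2 ?_
  · exact hf.aestronglyMeasurable.prod_swap.integral_prod_right'
  · simpa only [sq] using integrable_integral_mul_integral hf hf

lemma integral_sq_integral_le (hf : MemLp f.uncurry 2 (μ.prod P)) :
    ∫ ω, (∫ x, f x ω ∂μ) ^ 2 ∂P ≤ μ.real univ * ∫ x, ∫ ω, f x ω ^ 2 ∂P ∂μ := by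
  have hsq := hf.integrable_sq
  rw [integral_integral_swap hsq, ← integral_const_mul]
  refine integral_mono_ae (memLp_integral hf).integrable_sq (hsq.integral_prod_right.const_mul _) ?_
  filter_upwards [hsq.prod_left_ae, hf.aestronglyMeasurable.prod_swap.prodMk_left] with ω hω hm
  exact sq_integral_le ((memLp_two_iff_integrable_sq hm).2 hω)

end ParametricIntegral

lemma aestronglyMeasurable_uncurry_of_continuous {ι Ω : Type*} [TopologicalSpace ι]
    [TopologicalSpace.MetrizableSpace ι] [SecondCountableTopology ι] [MeasurableSpace ι]
    [OpensMeasurableSpace ι] {mΩ : MeasurableSpace Ω} {P : Measure Ω} {X : ι → Ω → ℝ}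
    (hX : ∀ t, AEMeasurable (X t) P) (hcont : ∀ᵐ ω ∂P, Continuous fun t => X t ω)
    (μ : Measure ι) : AEStronglyMeasurable X.uncurry (μ.prod P) := by
  obtain ⟨s, hs, hdense⟩ := TopologicalSpace.exists_countable_dense ι
  have hgood : ∀ᵐ ω ∂P, (∀ t ∈ s, X t ω = (hX t).mk (X t) ω) ∧ Continuous fun t => X t ω :=
    ((ae_ball_iff hs).2 fun t _ => (hX t).ae_eq_mk).and hcont
  obtain ⟨N, hN, hNm, hN0⟩ := exists_measurable_superset_of_null (ae_iff.1 hgood)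
  have hgood' (ω : Ω) (hω : ω ∉ N) := not_not.1 fun h => hω (hN h)
  let Y (t : ι) : Ω → ℝ := Nᶜ.indicator (X t)
  have hYcont (ω : Ω) : Continuous fun t => Y t ω := by
    by_cases hω : ω ∈ N
    · simp [Y, hω, continuous_const]
    · simpa [Y, hω] using (hgood' ω hω).2
  have hYmeas (t : ι) : Measurable (Y t) := by
    obtain ⟨d, hds, hdt⟩ := mem_closure_iff_seq_limit.1 (hdense t)
    refine measurable_of_tendsto_metrizable (f := fun n => Y (d n)) (fun n => ?_)
      (tendsto_pi_nhds.2 fun ω => ((hYcont ω).tendsto t).comp hdt)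
    have : Y (d n) = Nᶜ.indicator ((hX (d n)).mk (X (d n))) :=
      indicator_congr fun ω hω => (hgood' ω hω).1 _ (hds n)
    exact this ▸ (hX (d n)).measurable_mk.indicator hNm.compl
  refine ((measurable_uncurry_of_continuous_of_measurable hYcont
    hYmeas).aestronglyMeasurable).congr ?_
  filter_upwards [Measure.quasiMeasurePreserving_snd.ae (measure_eq_zero_iff_ae_notMem.1 hN0)]
    with z hz
  simp [Y, Function.uncurry, hz]

section BrownianMoments

variable {Ω : Type*} {mΩ : MeasurableSpace Ω} {P : Measure Ω} {W : ℝ≥0 → Ω → ℝ}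
  (hW : IsPreBrownianReal W P)
include hW

lemma integral_brownian_pow (t : ℝ≥0) (n : ℕ) : ∫ ω, W t ω ^ n ∂P = gaussianMoment t n :=
  integral_pow_of_hasLaw (hW.hasLaw_eval t) n

lemma memLp_two_brownian_pow (t : ℝ≥0) (n : ℕ) : MemLp (fun ω => W t ω ^ n) 2 P :=
  memLp_two_pow_of_hasLaw (hW.hasLaw_eval t) n

lemma integral_brownian_pow_mul_pow {s t : ℝ≥0} (hst : s ≤ t) (a b : ℕ) :
    ∫ ω, W s ω ^ a * W t ω ^ b ∂P = jointGaussianMoment s s t a b := by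
  obtain ⟨v, rfl⟩ := exists_add_of_le hst
  have hincr : HasLaw (W (s + v) - W s) (gaussianReal 0 v) P := by
    convert hW.hasLaw_sub (s + v) s using 2
    ext
    simp
  have hindep := hW.hasIndepIncrements.indepFun_eval_sub zero_le hst hW.eval_zero_ae_eq_zero
  simpa using integral_pow_mul_add_pow (hW.hasLaw_eval s) hincr hindep a b

lemma integral_brownian_pow_mul_pow_of_odd (s t : ℝ≥0) {a b : ℕ} (hab : Odd (a + b)) :
    ∫ ω, W s ω ^ a * W t ω ^ b ∂P = 0 := by
  rcases le_total s t with h | h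
  · rw [integral_brownian_pow_mul_pow hW h, jointGaussianMoment_of_odd _ _ _ hab]
  · simp only [mul_comm (W s _ ^ a)]
    rw [integral_brownian_pow_mul_pow hW h, jointGaussianMoment_of_odd _ _ _ (add_comm a b ▸ hab)]

lemma integral_brownian_pow_mul_pow_self {m : ℕ} (hm : 0 < m) (s t : ℝ≥0) :
    ∫ ω, W s ω ^ m * W t ω ^ m ∂P = mixedKernel m s t := by
  wlog h : s ≤ t generalizing s t with symm
  · simpa only [mul_comm, mixedKernel_comm m s t] using symm t s (le_of_not_ge h)
  rcases eq_zero_or_pos s with rfl | hs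
  · have hzero : mixedKernel m 0 t = 0 := by simp [mixedKernel, hm.ne']
    rw [NNReal.coe_zero, hzero]
    refine integral_eq_zero_of_ae ?_
    filter_upwards [hW.eval_zero_ae_eq_zero] with ω hω
    simp [hω, hm.ne']
  · rw [integral_brownian_pow_mul_pow hW h, mixedKernel_eq_jointGaussianMoment m (mod_cast hs)
      (mod_cast hs.trans_le h), min_eq_left (mod_cast h)]

lemma integral_brownian_mul (s t : ℝ≥0) : ∫ ω, W s ω * W t ω ∂P = min (s : ℝ) t := by
  wlog h : s ≤ t generalizing s t with symm
  · simpa only [mul_comm, min_comm (s : ℝ)] using symm t s (le_of_not_ge h)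
  rw [min_eq_left (mod_cast h), ← jointGaussianMoment_one_one s s t,
    ← integral_brownian_pow_mul_pow hW h]
  simp only [pow_one]

lemma integral_sq_mul_brownian_pow (a : ℝ) {u : ℝ} (hu : 0 ≤ u) (k : ℕ) :
    ∫ ω, (a * W u.toNNReal ω ^ k) ^ 2 ∂P = a ^ 2 * gaussianMoment u (2 * k) := by
  simp only [mul_pow, ← pow_mul', integral_const_mul, integral_brownian_pow hW,
    Real.coe_toNNReal u hu]

end BrownianMoments

/-- The time integral `∫₀ᵗ c(u) W_u ^ k du`; the solution of the system and its Taylor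
approximation are polynomials in `σ` with these coefficients. -/
noncomputable def powerIntegral {Ω : Type*} (c : ℝ → ℝ) (W : ℝ≥0 → Ω → ℝ) (t : ℝ≥0) (k : ℕ)
    (ω : Ω) : ℝ :=
  ∫ u in (0 : ℝ)..t, c u * W u.toNNReal ω ^ k

section PowerIntegral

variable {c : ℝ → ℝ} (hc : ContinuousOn c (Ici 0))
include hc

lemma intervalIntegrable_sq_mul_gaussianMoment (k : ℕ) {T : ℝ} (hT : 0 ≤ T) :
    IntervalIntegrable (fun u => c u ^ 2 * gaussianMoment u (2 * k)) volume 0 T := by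
  have hc' : ContinuousOn c (uIcc 0 T) := hc.mono (uIcc_of_le hT ▸ Icc_subset_Ici_self)
  simp only [gaussianMoment_two_mul]
  exact ContinuousOn.intervalIntegrable (by fun_prop)

variable {Ω : Type*} {mΩ : MeasurableSpace Ω} {P : Measure Ω} {W : ℝ≥0 → Ω → ℝ}
  (hW : IsBrownianReal W P)
include hW

lemma memLp_two_uncurry_mul_brownian_pow (t : ℝ≥0) (k : ℕ) :
    MemLp (Function.uncurry fun (u : ℝ) ω => c u * W u.toNNReal ω ^ k) 2
      ((volume.restrict (Ioc 0 (t : ℝ))).prod P) := by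
  have := hW.isGaussianProcess.isProbabilityMeasure
  have hWm : AEStronglyMeasurable (Function.uncurry fun (u : ℝ) ω => W u.toNNReal ω)
      ((volume.restrict (Ioc 0 (t : ℝ))).prod P) :=
    aestronglyMeasurable_uncurry_of_continuous (fun u => hW.aemeasurable _)
      (hW.cont.mono fun ω h => h.comp continuous_real_toNNReal) _
  have hcm : AEStronglyMeasurable c (volume.restrict (Ioc 0 (t : ℝ))) :=
    (hc.mono (Ioc_subset_Icc_self.trans Icc_subset_Ici_self)).aestronglyMeasurable measurableSet_Ioc
  have hm : AEStronglyMeasurable (Function.uncurry fun (u : ℝ) ω => c u * W u.toNNReal ω ^ k)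
      ((volume.restrict (Ioc 0 (t : ℝ))).prod P) := hcm.comp_fst.mul (hWm.pow k)
  refine (memLp_two_iff_integrable_sq hm).2 ((integrable_prod_iff (hm.pow 2)).2 ⟨?_, ?_⟩)
  · exact ae_of_all _ fun u =>
      ((memLp_two_brownian_pow hW.toIsPreBrownianReal u.toNNReal k).const_mul (c u)).integrable_sq
  · refine ((intervalIntegrable_iff_integrableOn_Ioc_of_le t.coe_nonneg).1
      (intervalIntegrable_sq_mul_gaussianMoment hc k t.coe_nonneg)).congr ?_
    filter_upwards [ae_restrict_mem measurableSet_Ioc] with u hu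
    simp only [Pi.pow_apply, norm_pow, Real.norm_eq_abs, sq_abs, Function.uncurry_apply_pair]
    exact (integral_sq_mul_brownian_pow hW.toIsPreBrownianReal (c u) hu.1.le k).symm

lemma memLp_powerIntegral (t : ℝ≥0) (k : ℕ) : MemLp (powerIntegral c W t k) 2 P := by
  have := hW.isGaussianProcess.isProbabilityMeasure
  unfold powerIntegral
  simp only [intervalIntegral.integral_of_le t.coe_nonneg]
  exact memLp_integral (memLp_two_uncurry_mul_brownian_pow hc hW t k)

lemma integral_powerIntegral (t : ℝ≥0) (k : ℕ) :
    ∫ ω, powerIntegral c W t k ω ∂P = ∫ u in (0 : ℝ)..t, c u * gaussianMoment u k := by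
  have := hW.isGaussianProcess.isProbabilityMeasure
  have h := (memLp_two_uncurry_mul_brownian_pow hc hW t k).integrable one_le_two
  simp only [powerIntegral, intervalIntegral.integral_of_le t.coe_nonneg]
  rw [← integral_integral_swap h]
  refine setIntegral_congr_fun measurableSet_Ioc fun u hu => ?_
  simp only [integral_const_mul, integral_brownian_pow hW.toIsPreBrownianReal,
    Real.coe_toNNReal u hu.1.le]

lemma integral_powerIntegral_two_mul (t : ℝ≥0) (j : ℕ) :
    ∫ ω, powerIntegral c W t (2 * j) ω ∂P
      = ((2 * j)! : ℝ) / (2 ^ j * (j ! : ℝ)) * ∫ u in (0 : ℝ)..t, c u * u ^ j := by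
  simp only [integral_powerIntegral hc hW, gaussianMoment_two_mul, mul_left_comm (c _),
    intervalIntegral.integral_const_mul]

lemma integral_powerIntegral_of_odd (t : ℝ≥0) {k : ℕ} (hk : Odd k) :
    ∫ ω, powerIntegral c W t k ω ∂P = 0 := by
  simp [integral_powerIntegral hc hW, gaussianMoment_of_odd _ hk]

lemma integral_powerIntegral_eq_meanShift (t : ℝ≥0) (m : ℕ) :
    ∫ ω, powerIntegral c W t m ω ∂P = meanShift m c t := by
  rcases m.even_or_odd with hm | hm
  · obtain ⟨j, rfl⟩ := hm.two_dvd
    simp [integral_powerIntegral_two_mul hc hW, meanShift]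
  · rw [integral_powerIntegral_of_odd hc hW t hm, meanShift, if_neg (Nat.not_even_iff_odd.2 hm)]

lemma integral_powerIntegral_mul (t : ℝ≥0) (j k : ℕ) {E : ℝ → ℝ → ℝ}
    (hE : ∀ s u : ℝ≥0, ∫ ω, W s ω ^ j * W u ω ^ k ∂P = E s u) :
    ∫ ω, powerIntegral c W t j ω * powerIntegral c W t k ω ∂P
      = ∫ s in (0 : ℝ)..t, ∫ u in (0 : ℝ)..t, c s * c u * E s u := by
  have := hW.isGaussianProcess.isProbabilityMeasure
  simp only [powerIntegral, intervalIntegral.integral_of_le t.coe_nonneg]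
  rw [integral_integral_mul_integral (memLp_two_uncurry_mul_brownian_pow hc hW t j)
    (memLp_two_uncurry_mul_brownian_pow hc hW t k)]
  refine setIntegral_congr_fun measurableSet_Ioc fun s hs =>
    setIntegral_congr_fun measurableSet_Ioc fun u hu => ?_
  simp only [mul_mul_mul_comm (c s), integral_const_mul, hE, Real.coe_toNNReal _ hs.1.le,
    Real.coe_toNNReal _ hu.1.le]

lemma integral_powerIntegral_mul_of_odd (t : ℝ≥0) {j k : ℕ} (hjk : Odd (j + k)) :
    ∫ ω, powerIntegral c W t j ω * powerIntegral c W t k ω ∂P = 0 := by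
  simp [integral_powerIntegral_mul hc hW t j k (E := fun _ _ => 0) fun s u =>
    integral_brownian_pow_mul_pow_of_odd hW.toIsPreBrownianReal s u hjk]

lemma integral_sq_powerIntegral (t : ℝ≥0) {m : ℕ} (hm : 0 < m) :
    ∫ ω, powerIntegral c W t m ω ^ 2 ∂P
      = ∫ s in (0 : ℝ)..t, ∫ u in (0 : ℝ)..t, c s * c u * mixedKernel m s u := by
  simp only [sq]
  exact integral_powerIntegral_mul hc hW t m m
    (integral_brownian_pow_mul_pow_self hW.toIsPreBrownianReal hm)

lemma integral_sq_powerIntegral_one (t : ℝ≥0) :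
    ∫ ω, powerIntegral c W t 1 ω ^ 2 ∂P
      = ∫ s in (0 : ℝ)..t, ∫ u in (0 : ℝ)..t, c s * c u * min s u := by
  simp only [sq]
  exact integral_powerIntegral_mul hc hW t 1 1 fun s u => by
    simpa only [pow_one] using integral_brownian_mul hW.toIsPreBrownianReal s u

lemma integral_sq_powerIntegral_le {t : ℝ≥0} {T : ℝ} (htT : t ≤ T) (k : ℕ) :
    ∫ ω, powerIntegral c W t k ω ^ 2 ∂P
      ≤ T * ∫ u in (0 : ℝ)..T, c u ^ 2 * gaussianMoment u (2 * k) := by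
  have := hW.isGaussianProcess.isProbabilityMeasure
  have hT : 0 ≤ T := t.coe_nonneg.trans htT
  have hnonneg : ∀ u, 0 ≤ u → 0 ≤ c u ^ 2 * gaussianMoment u (2 * k) := fun u hu => by
    rw [gaussianMoment_two_mul]; positivity
  calc ∫ ω, powerIntegral c W t k ω ^ 2 ∂P
      ≤ t * ∫ u in (0 : ℝ)..t, ∫ ω, (c u * W u.toNNReal ω ^ k) ^ 2 ∂P := by
        have h := integral_sq_integral_le (memLp_two_uncurry_mul_brownian_pow hc hW t k)
        simpa [powerIntegral, intervalIntegral.integral_of_le t.coe_nonneg] using h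
    _ = t * ∫ u in (0 : ℝ)..t, c u ^ 2 * gaussianMoment u (2 * k) := by
        congr 1
        refine intervalIntegral.integral_congr fun u hu => ?_
        exact integral_sq_mul_brownian_pow hW.toIsPreBrownianReal _
          (uIcc_of_le t.coe_nonneg ▸ hu).1 k
    _ ≤ T * ∫ u in (0 : ℝ)..T, c u ^ 2 * gaussianMoment u (2 * k) := by
        gcongr
        · exact intervalIntegral.integral_nonneg t.coe_nonneg fun u hu => hnonneg u hu.1
        · refine intervalIntegral.integral_mono_interval le_rfl t.coe_nonneg htT ?_
            (intervalIntegrable_sq_mul_gaussianMoment hc k hT)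
          filter_upwards [ae_restrict_mem measurableSet_Ioc] with u hu using hnonneg u hu.1.le

end PowerIntegral

section RatPow

lemma sign_mul_rpow_abs {q : ℝ} (hq : 0 < q) (x : ℝ) :
    Real.sign x * |x| ^ q = max x 0 ^ q - max (-x) 0 ^ q := by
  rcases lt_trichotomy x 0 with h | rfl | h
  · simp [Real.sign_of_neg h, abs_of_neg h, h.le, hq.ne']
  · simp
  · simp [Real.sign_of_pos h, abs_of_pos h, h.le, hq.ne']

lemma continuous_ratPow {m : ℚ} (hm : 0 < m) : Continuous fun x => ratPow x m := by
  have hq : (0 : ℝ) < m := mod_cast hm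
  unfold ratPow
  split_ifs
  · exact continuous_abs.rpow_const fun _ => .inr hq.le
  · simp only [sign_mul_rpow_abs hq]
    exact ((continuous_id.max continuous_const).rpow_const fun _ => .inr hq.le).sub
      ((continuous_neg.max continuous_const).rpow_const fun _ => .inr hq.le)

lemma ratPow_of_pos {x : ℝ} (hx : 0 < x) (q : ℚ) : ratPow x q = x ^ (q : ℝ) := by
  simp [ratPow, Real.sign_of_pos hx, abs_of_pos hx]

lemma ratPow_neg_of_not_even {q : ℚ} (hq : ¬ Even q.num) (x : ℝ) :
    ratPow (-x) q = -ratPow x q := by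
  simp [ratPow, hq, Real.sign_neg]

lemma ratPow_mul_of_pos {x : ℝ} (hx : 0 < x) (y : ℝ) (q : ℚ) :
    ratPow (x * y) q = ratPow x q * ratPow y q := by
  have hsign : Real.sign (x * y) = Real.sign y := by
    rcases lt_trichotomy y 0 with h | rfl | h
    · rw [Real.sign_of_neg h, Real.sign_of_neg (mul_neg_of_pos_of_neg hx h)]
    · rw [mul_zero]
    · rw [Real.sign_of_pos h, Real.sign_of_pos (mul_pos hx h)]
  rw [ratPow_of_pos hx, ratPow, ratPow, hsign, abs_mul, abs_of_pos hx,
    Real.mul_rpow hx.le (abs_nonneg y)]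
  split_ifs <;> ring

lemma ratPow_natCast (x : ℝ) (m : ℕ) : ratPow x m = x ^ m := by
  simp only [ratPow, Rat.cast_natCast, Real.rpow_natCast, Rat.num_natCast, Int.even_coe_nat]
  split_ifs with hm
  · exact hm.pow_abs x
  · rw [Nat.not_even_iff_odd] at hm
    rcases lt_trichotomy x 0 with h | rfl | h
    · simp [Real.sign_of_neg h, abs_of_neg h, hm.neg_pow]
    · simp [hm.pos.ne']
    · simp [Real.sign_of_pos h, abs_of_pos h]

lemma ratPow_zero_right (x : ℝ) : ratPow x 0 = 1 := by
  simpa using ratPow_natCast x 0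

lemma ratPow_one_right (x : ℝ) : ratPow x 1 = x := by
  simpa using ratPow_natCast x 1

lemma ratRoot_zero (m : ℚ) : ratRoot 0 m = 0 := by
  simp [ratRoot]

lemma ratRoot_neg (x : ℝ) (m : ℚ) : ratRoot (-x) m = -ratRoot x m := by
  simp [ratRoot, Real.sign_neg]

lemma ratRoot_ratPow {m : ℚ} (hm : 0 < m) {x : ℝ} (hx : Even m.num → 0 ≤ x) :
    ratRoot (ratPow x m) m = x := by
  have hq : (m : ℝ) ≠ 0 := mod_cast hm.ne'
  have of_pos {y : ℝ} (hy : 0 < y) : ratRoot (ratPow y m) m = y := by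
    have hpow := Real.rpow_pos_of_pos hy m
    rw [ratPow_of_pos hy, ratRoot, Real.sign_of_pos hpow, abs_of_pos hpow, one_mul, one_div,
      Real.rpow_rpow_inv hy.le hq]
  rcases lt_trichotomy x 0 with h | rfl | h
  · have hodd : ¬ Even m.num := fun he => (hx he).not_gt h
    rw [← neg_neg x, ratPow_neg_of_not_even hodd, ratRoot_neg, of_pos (neg_pos.2 h)]
  · simp [ratPow, ratRoot, hq]
  · exact of_pos h

end RatPow

lemma hasDerivWithinAt_integral_Ici {f : ℝ → ℝ} {a t : ℝ} (hf : ContinuousOn f (Ici a))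
    (ht : a ≤ t) : HasDerivWithinAt (fun u => ∫ s in a..u, f s) (f t) (Ici a) t := by
  have hext : Continuous fun s => f (max a s) :=
    hf.comp_continuous (by fun_prop) fun s => le_max_left a s
  have hderiv := (hext.integral_hasStrictDerivAt a t).hasDerivAt.hasDerivWithinAt (s := Ici a)
  rw [max_eq_right ht] at hderiv
  refine hderiv.congr_of_mem (fun u hu => intervalIntegral.integral_congr fun s hs => ?_) ht
  simp [(uIcc_of_le (mem_Ici.1 hu) ▸ hs).1]

lemma continuousOn_integral_Ici {f : ℝ → ℝ} {a : ℝ} (hf : ContinuousOn f (Ici a)) :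
    ContinuousOn (fun u => ∫ s in a..u, f s) (Ici a) := fun _ ht =>
  (hasDerivWithinAt_integral_Ici hf ht).continuousWithinAt

section RiemannSum

variable {S D w : ℝ → ℝ} {C ε : ℝ}

lemma abs_integral_mul_sub_mul_sub_le {a b : ℝ} (hab : a ≤ b)
    (hS : ∀ s ∈ Icc a b, HasDerivWithinAt S (D s) (Icc a b) s) (hD : ContinuousOn D (Icc a b))
    (hw : ContinuousOn w (Icc a b)) (hC : ∀ s ∈ Icc a b, |D s| ≤ C)
    (hε : ∀ s ∈ Icc a b, |w s - w b| ≤ ε) :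
    |(∫ s in a..b, D s * w s) - w b * (S b - S a)| ≤ C * ε * (b - a) := by
  have hC0 : 0 ≤ C := (abs_nonneg _).trans (hC a (left_mem_Icc.2 hab))
  rw [← uIcc_of_le hab] at hD hw
  have hint : IntervalIntegrable (fun s => D s * w s) volume a b := (hD.mul hw).intervalIntegrable
  have hFTC : ∫ s in a..b, D s = S b - S a :=
    intervalIntegral.integral_eq_sub_of_hasDerivAt_of_le hab
      (fun s hs => (hS s hs).continuousWithinAt)
      (fun s hs => (hS s (Ioo_subset_Icc_self hs)).hasDerivAt (Icc_mem_nhds hs.1 hs.2))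
      hD.intervalIntegrable
  rw [← hFTC, ← intervalIntegral.integral_const_mul,
    ← intervalIntegral.integral_sub hint (hD.intervalIntegrable.const_mul _),
    ← Real.norm_eq_abs, ← abs_of_nonneg (sub_nonneg.2 hab)]
  refine intervalIntegral.norm_integral_le_of_norm_le_const fun s hs => ?_
  have hs' := Ioc_subset_Icc_self (uIoc_of_le hab ▸ hs)
  rw [mul_comm (w b), ← mul_sub, norm_mul]
  exact mul_le_mul (hC s hs') (hε s hs') (abs_nonneg _) hC0

lemma abs_integral_mul_sub_sum_le {x : ℕ → ℝ} (hx : Monotone x) (N : ℕ)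
    (hS : ∀ s ∈ Icc (x 0) (x N), HasDerivWithinAt S (D s) (Icc (x 0) (x N)) s)
    (hD : ContinuousOn D (Icc (x 0) (x N))) (hw : ContinuousOn w (Icc (x 0) (x N)))
    (hC : ∀ s ∈ Icc (x 0) (x N), |D s| ≤ C)
    (hε : ∀ i < N, ∀ s ∈ Icc (x i) (x (i + 1)), |w s - w (x (i + 1))| ≤ ε) :
    |(∫ s in (x 0)..(x N), D s * w s)
        - ∑ i ∈ Finset.range N, w (x (i + 1)) * (S (x (i + 1)) - S (x i))|
      ≤ C * ε * (x N - x 0) := by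
  have hsub {i : ℕ} (hi : i < N) : Icc (x i) (x (i + 1)) ⊆ Icc (x 0) (x N) :=
    Icc_subset_Icc (hx i.zero_le) (hx hi)
  have hint : ∀ i < N, IntervalIntegrable (fun s => D s * w s) volume (x i) (x (i + 1)) :=
    fun i hi => ((hD.mul hw).mono (uIcc_of_le (hx i.le_succ) ▸ hsub hi)).intervalIntegrable
  rw [← intervalIntegral.sum_integral_adjacent_intervals hint,
    ← Finset.sum_sub_distrib, ← Finset.sum_range_sub, Finset.mul_sum]
  refine (Finset.abs_sum_le_sum_abs _ _).trans (Finset.sum_le_sum fun i hi => ?_)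
  have hi := Finset.mem_range.1 hi
  exact abs_integral_mul_sub_mul_sub_le (hx i.le_succ)
    (fun s hs => (hS s (hsub hi hs)).mono (hsub hi)) (hD.mono (hsub hi)) (hw.mono (hsub hi))
    (fun s hs => hC s (hsub hi hs)) (hε i hi)

lemma sum_mul_sub_add_sum_mul_sub (f g : ℕ → ℝ) (N : ℕ) :
    ∑ i ∈ Finset.range N, f i * (g (i + 1) - g i)
      + ∑ i ∈ Finset.range N, g (i + 1) * (f (i + 1) - f i) = f N * g N - f 0 * g 0 := by
  rw [← Finset.sum_add_distrib, ← Finset.sum_range_sub fun i => f i * g i]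
  exact Finset.sum_congr rfl fun i _ => by ring

lemma eventually_abs_sub_uniformPartition_le {t : ℝ} (ht : 0 ≤ t) (hw : ContinuousOn w (Icc 0 t))
    (hε : 0 < ε) :
    ∀ᶠ N : ℕ in atTop, ∀ i < N, ∀ s ∈ Icc (i * t / N) ((i + 1 : ℕ) * t / N),
      |w s - w ((i + 1 : ℕ) * t / N)| ≤ ε := by
  obtain ⟨δ, hδ, hδw⟩ := Metric.uniformContinuousOn_iff_le.1
    (isCompact_Icc.uniformContinuousOn_of_continuous hw) ε hε
  filter_upwards [(tendsto_const_div_atTop_nhds_zero_nat t).eventually_le_const hδ,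
    eventually_gt_atTop 0] with N hmesh hN i hi s hs
  have hN' : (0 : ℝ) < N := mod_cast hN
  have hle : ((i + 1 : ℕ) : ℝ) * t / N ≤ t := by
    rw [div_le_iff₀ hN', mul_comm]
    gcongr
    exact hi
  have hlen : ((i + 1 : ℕ) : ℝ) * t / N - i * t / N = t / N := by push_cast; ring
  have hge : 0 ≤ s := le_trans (by positivity) hs.1
  refine hδw s ⟨hge, hs.2.trans hle⟩ _ ⟨hge.trans hs.2, hle⟩ ?_
  rw [Real.dist_eq, abs_sub_comm, abs_of_nonneg (sub_nonneg.2 hs.2)]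
  linarith [hs.1]

lemma tendsto_sum_mul_sub {t : ℝ} (ht : 0 ≤ t)
    (hS : ∀ s ∈ Icc 0 t, HasDerivWithinAt S (D s) (Icc 0 t) s) (hD : ContinuousOn D (Icc 0 t))
    (hw : ContinuousOn w (Icc 0 t)) :
    Tendsto (fun N : ℕ => ∑ i ∈ Finset.range N,
        S (i * t / N) * (w ((i + 1 : ℕ) * t / N) - w (i * t / N))) atTop
      (𝓝 (S t * w t - S 0 * w 0 - ∫ s in (0 : ℝ)..t, D s * w s)) := by
  obtain ⟨C, hC⟩ := isCompact_Icc.exists_bound_of_continuousOn hD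
  have hC0 : 0 ≤ C := (norm_nonneg _).trans (hC 0 (left_mem_Icc.2 ht))
  refine Metric.tendsto_nhds.2 fun ε hε => ?_
  filter_upwards [eventually_abs_sub_uniformPartition_le ht hw
    (show 0 < ε / (C * t + 1) by positivity), eventually_gt_atTop 0] with N hosc hN
  have hN' : (N : ℝ) ≠ 0 := mod_cast hN.ne'
  let x (i : ℕ) : ℝ := i * t / N
  have hx : Monotone x := fun i j hij => by dsimp only [x]; gcongr
  have hx0 : x 0 = 0 := by simp [x]
  have hxN : x N = t := by simp [x, hN']
  have hbound := abs_integral_mul_sub_sum_le (S := S) (D := D) (C := C) hx N (by rwa [hx0, hxN])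
    (by rwa [hx0, hxN]) (by rwa [hx0, hxN]) (by rwa [hx0, hxN]) hosc
  have hparts := sum_mul_sub_add_sum_mul_sub (fun i => S (x i)) (fun i => w (x i)) N
  simp only [hx0, hxN, sub_zero] at hbound hparts
  calc dist (∑ i ∈ Finset.range N, S (x i) * (w (x (i + 1)) - w (x i)))
        (S t * w t - S 0 * w 0 - ∫ s in (0 : ℝ)..t, D s * w s)
      = |(∫ s in (0 : ℝ)..t, D s * w s)
          - ∑ i ∈ Finset.range N, w (x (i + 1)) * (S (x (i + 1)) - S (x i))| := by
        rw [Real.dist_eq, ← hparts]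
        congr 1; ring
    _ ≤ C * (ε / (C * t + 1)) * t := hbound
    _ < ε := by
        rw [mul_div_assoc', div_mul_eq_mul_div, div_lt_iff₀ (by positivity)]
        linarith

end RiemannSum

lemma eq_exp_neg_integral_mul {q f g : ℝ → ℝ} {a t : ℝ} (hq : ContinuousOn q (Ici a))
    (hf : ContinuousOn f (Ici a))
    (hg : ∀ s ∈ Ici a, HasDerivWithinAt g (f s - q s * g s) (Ici a) s) (ht : a ≤ t) :
    g t = Real.exp (-∫ s in a..t, q s) *
      ((∫ s in a..t, Real.exp (∫ v in a..s, q v) * f s) + g a) := by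
  have hexp : ContinuousOn (fun s => Real.exp (∫ v in a..s, q v) * f s) (Ici a) :=
    (Real.continuous_exp.comp_continuousOn (continuousOn_integral_Ici hq)).mul hf
  let F (s : ℝ) : ℝ :=
    Real.exp (∫ v in a..s, q v) * g s - ∫ v in a..s, Real.exp (∫ u in a..v, q u) * f v
  have hF : ∀ s ∈ Ici a, HasDerivWithinAt F 0 (Ici a) s := by
    intro s hs
    refine (((hasDerivWithinAt_integral_Ici hq hs).exp.mul (hg s hs)).sub
      (hasDerivWithinAt_integral_Ici hexp hs)).congr_deriv ?_
    ring
  have hconst : F t = F a :=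
    constant_of_has_deriv_right_zero
      (fun s hs => (hF s hs.1).continuousWithinAt.mono Icc_subset_Ici_self)
      (fun s hs => (hF s hs.1).mono (Ici_subset_Ici.2 hs.1)) t (right_mem_Icc.2 ht)
  simp only [F, intervalIntegral.integral_same, Real.exp_zero, one_mul, sub_zero] at hconst
  rw [Real.exp_neg, eq_inv_mul_iff_mul_eq₀ (Real.exp_ne_zero _)]
  linarith

lemma continuousOn_rate {a σ : ℝ → ℝ} (ha : ContinuousOn a (Ici 0))
    (hσ : ContDiffOn ℝ 1 σ (Ici 0)) (hσ0 : ∀ t, 0 ≤ t → σ t ≠ 0) :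
    ContinuousOn (rate a σ) (Ici 0) :=
  ((hσ.continuousOn_derivWithin (uniqueDiffOn_Ici 0) le_rfl).div hσ.continuousOn hσ0).sub ha

-- Here `y = p - σ w`: the function `p / σ - w + s / 2` solves a linear equation without stochastic
-- term.
lemma hasDerivWithinAt_div_add_half {a σ w y : ℝ → ℝ} {s : ℝ}
    (hσ : DifferentiableWithinAt ℝ σ (Ici 0) s) (hσs : σ s ≠ 0)
    (hy : HasDerivWithinAt y (a s * (y s + σ s * w s) - derivWithin σ (Ici 0) s * w s) (Ici 0) s) :
    HasDerivWithinAt (fun s => y s / σ s + s / 2)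
      (1 / 2 * (1 + (-(derivWithin σ (Ici 0) s / σ s) + a s) * (2 * w s - s))
        - rate a σ s * (y s / σ s + s / 2)) (Ici 0) s := by
  refine ((hy.div hσ.hasDerivWithinAt hσs).add
    ((hasDerivWithinAt_id s (Ici 0)).div_const 2)).congr_deriv ?_
  simp only [rate]
  field_simp
  ring

lemma eq_mul_of_linear_integral_eq {a σ w p : ℝ → ℝ} {t : ℝ} (ha : ContinuousOn a (Ici 0))
    (hσ : ContDiffOn ℝ 1 σ (Ici 0)) (hσ0 : ∀ t, 0 ≤ t → σ t ≠ 0) (hw : ContinuousOn w (Ici 0))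
    (hp : ContinuousOn p (Ici 0))
    (h : ∀ t, 0 ≤ t → p t = p 0 + (∫ s in (0 : ℝ)..t, a s * p s)
      + (σ t * w t - ∫ s in (0 : ℝ)..t, derivWithin σ (Ici 0) s * w s)) (ht : 0 ≤ t) :
    p t = σ t * (Real.exp (-∫ s in (0 : ℝ)..t, rate a σ s) *
        (1 / 2 * (∫ s in (0 : ℝ)..t, Real.exp (∫ v in (0 : ℝ)..s, rate a σ v) *
            (1 + (-(derivWithin σ (Ici 0) s / σ s) + a s) * (2 * w s - s)))
          + p 0 * (σ 0)⁻¹)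
      + w t - t / 2) := by
  have hσ' : ContinuousOn (derivWithin σ (Ici 0)) (Ici 0) :=
    hσ.continuousOn_derivWithin (uniqueDiffOn_Ici 0) le_rfl
  let y (s : ℝ) : ℝ := p 0 + (∫ v in (0 : ℝ)..s, a v * p v)
    - ∫ v in (0 : ℝ)..s, derivWithin σ (Ici 0) v * w v
  have hy : ∀ s, 0 ≤ s → p s = y s + σ s * w s := fun s hs => by linear_combination h s hs
  let g (s : ℝ) : ℝ := y s / σ s + s / 2
  let f (s : ℝ) : ℝ := 1 / 2 * (1 + (-(derivWithin σ (Ici 0) s / σ s) + a s) * (2 * w s - s))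
  have hf : ContinuousOn f (Ici 0) :=
    continuousOn_const.mul (continuousOn_const.add
      (((hσ'.div hσ.continuousOn hσ0).neg.add ha).mul
        ((continuousOn_const.mul hw).sub continuousOn_id)))
  have hg : ∀ s ∈ Ici 0, HasDerivWithinAt g (f s - rate a σ s * g s) (Ici 0) s := by
    intro s hs
    refine hasDerivWithinAt_div_add_half (hσ.differentiableOn one_ne_zero s hs) (hσ0 s hs) ?_
    rw [← hy s hs]
    exact ((hasDerivWithinAt_integral_Ici (ha.mul hp) hs).const_add _).sub
      (hasDerivWithinAt_integral_Ici (hσ'.mul hw) hs)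
  have hhalf : ∫ s in (0 : ℝ)..t, Real.exp (∫ v in (0 : ℝ)..s, rate a σ v) * f s
      = 1 / 2 * ∫ s in (0 : ℝ)..t, Real.exp (∫ v in (0 : ℝ)..s, rate a σ v) *
          (1 + (-(derivWithin σ (Ici 0) s / σ s) + a s) * (2 * w s - s)) := by
    simp only [← intervalIntegral.integral_const_mul, f, mul_left_comm]
  have hg0 : g 0 = p 0 * (σ 0)⁻¹ := by simp [g, y, div_eq_mul_inv]
  have hpg : p t = σ t * (g t + w t - t / 2) := by
    have := hσ0 t ht
    simp only [hy t ht, g]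
    field_simp
    ring
  rw [hpg, eq_exp_neg_integral_mul (continuousOn_rate ha hσ hσ0) hf hg ht, hhalf, hg0]

section Pathwise

variable {Ω : Type*} {mΩ : MeasurableSpace Ω} {P : Measure Ω} {𝓕 : Filtration ℝ≥0 mΩ}
  {W R p : ℝ≥0 → Ω → ℝ} {m n : ℚ} {a c σ : ℝ → ℝ} {A B : ℝ}

lemma IsItoIntegral.ae_eq_mul_sub_integral {I : Ω → ℝ} {t : ℝ≥0} (hW : IsBrownianReal W P)
    (hσ : ContDiffOn ℝ 1 σ (Ici 0)) (hI : IsItoIntegral 𝓕 W P (fun s _ => σ s) t I) :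
    ∀ᵐ ω ∂P, I ω = σ t * W t ω
      - ∫ s in (0 : ℝ)..t, derivWithin σ (Ici 0) s * W s.toNNReal ω := by
  have := hW.isGaussianProcess.isProbabilityMeasure
  refine tendstoInMeasure_ae_unique hI.tendsto (tendstoInMeasure_of_tendsto_ae (fun N => ?_) ?_)
  · exact Finset.aestronglyMeasurable_fun_sum _ fun i _ =>
      (((hW.aemeasurable _).sub (hW.aemeasurable _)).const_mul _).aestronglyMeasurable
  filter_upwards [hW.cont, hW.eval_zero_ae_eq_zero] with ω hWω hW0
  have hS (s : ℝ) (hs : s ∈ Icc 0 (t : ℝ)) :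
      HasDerivWithinAt σ (derivWithin σ (Ici 0) s) (Icc 0 t) s :=
    (hσ.differentiableOn one_ne_zero s hs.1).hasDerivWithinAt.mono Icc_subset_Ici_self
  have hlim := tendsto_sum_mul_sub t.coe_nonneg hS
    ((hσ.continuousOn_derivWithin (uniqueDiffOn_Ici 0) le_rfl).mono Icc_subset_Ici_self)
    (hWω.comp continuous_real_toNNReal).continuousOn
  simp only [Function.comp_apply, Real.toNNReal_coe, Real.toNNReal_zero, hW0, mul_zero,
    sub_zero] at hlim
  refine hlim.congr fun N => Finset.sum_congr rfl fun i _ => ?_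
  have hnode (j : ℕ) : (j : ℝ) * t / N = ((j * t / N : ℝ≥0) : ℝ) := by push_cast; rfl
  rw [hnode, hnode, Real.toNNReal_coe, Real.toNNReal_coe, Nat.cast_add, Nat.cast_one]

lemma IsSolution.momentum_eq (hW : IsBrownianReal W P)
    (h : IsSolution 𝓕 W P m n 0 1 a (fun _ => 0) c σ R p) (ha : ContinuousOn a (Ici 0))
    (hσ : ContDiffOn ℝ 1 σ (Ici 0)) :
    ∀ᵐ ω ∂P, ∀ t : ℝ≥0, p t ω = p 0 ω + (∫ s in (0 : ℝ)..t, a s * p s.toNNReal ω)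
      + (σ t * W t ω - ∫ s in (0 : ℝ)..t, derivWithin σ (Ici 0) s * W s.toNNReal ω) := by
  have hdense : ∀ᵐ ω ∂P, ∀ k : ℕ, _ := ae_all_iff.2 fun k : ℕ =>
    IsItoIntegral.ae_eq_mul_sub_integral (t := TopologicalSpace.denseSeq ℝ≥0 k) hW hσ
      (by simpa only [ratPow_zero_right, mul_one] using h.eq_p _)
  filter_upwards [hdense, hW.cont, h.cont_p] with ω hω hWω hpω
  have hprim {f : ℝ → ℝ} (hf : ContinuousOn f (Ici 0)) :
      Continuous fun t : ℝ≥0 => ∫ s in (0 : ℝ)..t, f s :=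
    (continuousOn_integral_Ici hf).comp_continuous NNReal.continuous_coe fun t => t.coe_nonneg
  have hdrift := hprim (ha.mul (hpω.comp continuous_real_toNNReal).continuousOn)
  have hnoise := hprim ((hσ.continuousOn_derivWithin (uniqueDiffOn_Ici 0) le_rfl).mul
    (hWω.comp continuous_real_toNNReal).continuousOn)
  have hσc : Continuous fun t : ℝ≥0 => σ t :=
    hσ.continuousOn.comp_continuous NNReal.continuous_coe fun t => t.coe_nonneg
  refine congrFun ((TopologicalSpace.denseRange_denseSeq ℝ≥0).equalizer hpω
    ((continuous_const.add hdrift).add ((hσc.mul hWω).sub hnoise)) (funext fun k => ?_))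
  have := hω k
  simp only [ratPow_one_right, zero_mul, add_zero] at this
  simp only [Function.comp_apply]
  linarith

lemma IsCauchySolution.initial_momentum {k l : ℚ} {b : ℝ → ℝ} (hm : 0 < m)
    (hc : ContinuousOn c (Ici 0)) (hc0 : c 0 ≠ 0)
    (h : IsCauchySolution 𝓕 W P m n k l a b c σ A B R p) :
    ∀ᵐ ω ∂P, p 0 ω = ratRoot (B / c 0) m := by
  have hroot : ∀ᵐ ω ∂P, Even m.num → 0 ≤ p 0 ω := ae_all_iff.2 h.root
  filter_upwards [h.cont_p, h.eq_r, h.init_deriv, hroot] with ω hpω hr hB hpos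
  have hint : ContinuousOn (fun s : ℝ => c s * ratPow (p s.toNNReal ω) m) (Ici 0) :=
    hc.mul ((continuous_ratPow hm).comp (hpω.comp continuous_real_toNNReal)).continuousOn
  have hderiv : HasDerivWithinAt (fun t : ℝ => R t.toNNReal ω) (c 0 * ratPow (p 0 ω) m)
      (Ici 0) 0 := by
    have hprim := (hasDerivWithinAt_integral_Ici hint le_rfl).const_add (R 0 ω)
    rw [Real.toNNReal_zero] at hprim
    exact hprim.congr_of_mem (fun t ht => by rw [hr, Real.coe_toNNReal _ ht]) self_mem_Ici
  rw [(uniqueDiffWithinAt_Ici 0).eq_deriv _ hB hderiv, mul_div_cancel_left₀ _ hc0,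
    ratRoot_ratPow hm hpos]

theorem IsCauchySolution.eq_explicitSolution (hm : 0 < m) (hc : ContinuousOn c (Ici 0))
    (hc0 : c 0 ≠ 0) (ha : ContinuousOn a (Ici 0)) (hσ : ContDiffOn ℝ 1 σ (Ici 0))
    (hσ0 : ∀ t, 0 ≤ t → 0 < σ t) (hW : IsBrownianReal W P)
    (h : IsCauchySolution 𝓕 W P m n 0 1 a (fun _ => 0) c σ A B R p) :
    ∀ᵐ ω ∂P, ∀ t : ℝ≥0, R t ω = explicitSolution m a c σ A B (fun s => W s ω) t := by
  filter_upwards [h.momentum_eq hW ha hσ, h.initial_momentum hm hc hc0, hW.cont, h.cont_p, h.eq_r,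
    h.init] with ω hp hp0 hWω hpω hr hR0 t
  rw [hr t, hR0, explicitSolution]
  congr 1
  refine intervalIntegral.integral_congr fun u hu => ?_
  have hu0 : 0 ≤ u := (uIcc_of_le t.coe_nonneg ▸ hu).1
  have hsol := eq_mul_of_linear_integral_eq (w := fun s => W s.toNNReal ω)
    (p := fun s => p s.toNNReal ω) ha hσ (fun s hs => (hσ0 s hs).ne')
    (hWω.comp continuous_real_toNNReal).continuousOn
    (hpω.comp continuous_real_toNNReal).continuousOn
    (fun s hs => by simpa [Real.coe_toNNReal s hs] using hp s.toNNReal) hu0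
  simp only [Real.toNNReal_zero, hp0] at hsol
  rw [hsol, ratPow_mul_of_pos (hσ0 u hu0)]
  ring

lemma explicitSolution_natCast_const {m : ℕ} {σ : ℝ} (hσ : σ ≠ 0) (w : ℝ≥0 → ℝ) (t : ℝ) :
    explicitSolution m (fun _ => 0) c (fun _ => σ) A B w t
      = A + ∫ u in (0 : ℝ)..t, c u * (ratRoot (B / c 0) m + σ * w u.toNNReal) ^ m := by
  have hrate : rate (fun _ => 0) (fun _ => σ) = fun _ => 0 := by
    ext s
    simp [rate]
  have hbase (u : ℝ) : ratRoot (B / c 0) m + σ * w u.toNNReal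
      = (1 / 2 * u + ratRoot (B / c 0) m * σ⁻¹ + w u.toNNReal - u / 2) * σ := by
    field_simp
    ring
  simp only [explicitSolution, hrate, ratPow_natCast, derivWithin_fun_const, hbase, mul_pow]
  simp [mul_comm (c _)]

end Pathwise

section Moments

lemma integral_sq_sum_le {ι Ω : Type*} {mΩ : MeasurableSpace Ω} {P : Measure Ω} {s : Finset ι}
    {X : ι → Ω → ℝ} (hX : ∀ i ∈ s, MemLp (X i) 2 P) :
    ∫ ω, (∑ i ∈ s, X i ω) ^ 2 ∂P ≤ s.card * ∑ i ∈ s, ∫ ω, X i ω ^ 2 ∂P := by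
  have hsq : ∀ i ∈ s, Integrable (fun ω => X i ω ^ 2) P := fun i hi => (hX i hi).integrable_sq
  rw [← integral_finsetSum s hsq, ← integral_const_mul]
  exact integral_mono (memLp_finsetSum s hX).integrable_sq
    ((integrable_finsetSum s hsq).const_mul _) fun ω => sq_sum_le_card_mul_sum_sq

variable {Ω : Type*} {mΩ : MeasurableSpace Ω} {P : Measure Ω} {X Y Z : Ω → ℝ}

lemma covariance_congr_left {X' : Ω → ℝ} (h : X =ᵐ[P] X') : cov[X, Y; P] = cov[X', Y; P] := by
  unfold covariance
  rw [integral_congr_ae h]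
  refine integral_congr_ae ?_
  filter_upwards [h] with ω hω
  rw [hω]

lemma abs_covariance_le [IsFiniteMeasure P] (hX : MemLp X 2 P) (hY : MemLp Y 2 P) :
    |cov[X, Y; P]| ≤ (Var[X; P] + Var[Y; P]) / 2 := by
  have hadd := variance_add hX hY ▸ variance_nonneg (X + Y) P
  have hsub := variance_sub hX hY ▸ variance_nonneg (X - Y) P
  rw [abs_le]
  constructor <;> linarith

lemma integral_sq_const_add_mul [IsProbabilityMeasure P] (hZ : MemLp Z 2 P)
    (hZ0 : ∫ ω, Z ω ∂P = 0) (κ α : ℝ) :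
    ∫ ω, (κ + α * Z ω) ^ 2 ∂P = κ ^ 2 + α ^ 2 * ∫ ω, Z ω ^ 2 ∂P := by
  have hZi : Integrable (fun ω => 2 * κ * α * Z ω) P := (hZ.integrable one_le_two).const_mul _
  have hlin : Integrable (fun ω => κ ^ 2 + 2 * κ * α * Z ω) P := (integrable_const _).add hZi
  calc ∫ ω, (κ + α * Z ω) ^ 2 ∂P
      = ∫ ω, (κ ^ 2 + 2 * κ * α * Z ω + α ^ 2 * Z ω ^ 2) ∂P := by
        congr with ω; ring
    _ = κ ^ 2 + α ^ 2 * ∫ ω, Z ω ^ 2 ∂P := by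
        rw [integral_add hlin (hZ.integrable_sq.const_mul _),
          integral_add (integrable_const _) hZi]
        simp [integral_const_mul, hZ0]

lemma variance_const_add_mul [IsProbabilityMeasure P] (hZ : MemLp Z 2 P) (κ α : ℝ) :
    Var[fun ω => κ + α * Z ω; P] = α ^ 2 * Var[Z; P] := by
  rw [variance_const_add (hZ.const_mul α).aestronglyMeasurable, variance_const_mul]

lemma abs_variance_add_mul_sub_le [IsProbabilityMeasure P] (hX : MemLp X 2 P) (hY : MemLp Y 2 P)
    (δ : ℝ) :
    |Var[fun ω => X ω + δ * Y ω; P] - Var[X; P]|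
      ≤ 2 * |δ| * |cov[X, Y; P]| + δ ^ 2 * ∫ ω, Y ω ^ 2 ∂P := by
  have hvar : Var[Y; P] ≤ ∫ ω, Y ω ^ 2 ∂P := variance_le_expectation_sq hY.aestronglyMeasurable
  calc |Var[fun ω => X ω + δ * Y ω; P] - Var[X; P]|
      = |2 * δ * cov[X, Y; P] + δ ^ 2 * Var[Y; P]| := by
        rw [variance_fun_add hX (hY.const_mul δ), covariance_const_mul_right, variance_const_mul]
        congr 1; ring
    _ ≤ |2 * δ * cov[X, Y; P]| + |δ ^ 2 * Var[Y; P]| := abs_add_le _ _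
    _ = 2 * |δ| * |cov[X, Y; P]| + δ ^ 2 * Var[Y; P] := by
        rw [abs_mul, abs_mul, abs_two,
          abs_of_nonneg (mul_nonneg (sq_nonneg δ) (variance_nonneg Y P))]
    _ ≤ 2 * |δ| * |cov[X, Y; P]| + δ ^ 2 * ∫ ω, Y ω ^ 2 ∂P := by gcongr

end Moments

lemma integral_mul_add_mul_pow {c w : ℝ → ℝ} {t : ℝ} (hc : ContinuousOn c (uIcc 0 t))
    (hw : ContinuousOn w (uIcc 0 t)) (x y : ℝ) (m : ℕ) :
    ∫ u in (0 : ℝ)..t, c u * (x + y * w u) ^ m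
      = ∑ k ∈ Finset.range (m + 1),
          m.choose k * x ^ (m - k) * y ^ k * ∫ u in (0 : ℝ)..t, c u * w u ^ k := by
  simp only [← intervalIntegral.integral_const_mul]
  rw [← intervalIntegral.integral_finsetSum fun k _ =>
    ContinuousOn.intervalIntegrable (by fun_prop)]
  congr with u
  rw [add_comm x, add_pow, Finset.mul_sum]
  exact Finset.sum_congr rfl fun k _ => by ring

section ConstantCoefficients

variable {Ω : Type*} {mΩ : MeasurableSpace Ω} {P : Measure Ω} {𝓕 : Filtration ℝ≥0 mΩ}
  {W R p : ℝ≥0 → Ω → ℝ} {m : ℕ} {n : ℚ} {c : ℝ → ℝ} {σ A B : ℝ}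

lemma IsCauchySolution.ae_eq_integral_pow (hm : 0 < m) (hc : ContinuousOn c (Ici 0))
    (hc0 : c 0 ≠ 0) (hσ : 0 < σ) (hW : IsBrownianReal W P)
    (h : IsCauchySolution 𝓕 W P m n 0 1 (fun _ => 0) (fun _ => 0) c (fun _ => σ) A B R p)
    (t : ℝ≥0) :
    R t =ᵐ[P] fun ω => A + ∫ u in (0 : ℝ)..t,
      c u * (ratRoot (B / c 0) m + σ * W u.toNNReal ω) ^ m := by
  filter_upwards [h.eq_explicitSolution (mod_cast hm) hc hc0 continuousOn_const contDiffOn_const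
    (fun _ _ => hσ) hW] with ω hω
  rw [hω, explicitSolution_natCast_const hσ.ne']

lemma IsCauchySolution.ae_eq_sum_powerIntegral (hm : 0 < m) (hc : ContinuousOn c (Ici 0))
    (hc0 : c 0 ≠ 0) (hσ : 0 < σ) (hW : IsBrownianReal W P)
    (h : IsCauchySolution 𝓕 W P m n 0 1 (fun _ => 0) (fun _ => 0) c (fun _ => σ) A B R p)
    (t : ℝ≥0) :
    R t =ᵐ[P] fun ω => A + ∑ k ∈ Finset.range (m + 1),
      m.choose k * ratRoot (B / c 0) m ^ (m - k) * σ ^ k * powerIntegral c W t k ω := by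
  filter_upwards [h.ae_eq_integral_pow hm hc hc0 hσ hW t, hW.cont] with ω hω hWω
  rw [hω, integral_mul_add_mul_pow (w := fun u => W u.toNNReal ω)
    (hc.mono (uIcc_of_le t.coe_nonneg ▸ Icc_subset_Ici_self))
    (hWω.comp continuous_real_toNNReal).continuousOn]
  rfl

theorem IsCauchySolution.memLp_two (hm : 0 < m) (hc : ContinuousOn c (Ici 0))
    (hc0 : c 0 ≠ 0) (hσ : 0 < σ) (hW : IsBrownianReal W P)
    (h : IsCauchySolution 𝓕 W P m n 0 1 (fun _ => 0) (fun _ => 0) c (fun _ => σ) A B R p)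
    (t : ℝ≥0) : MemLp (R t) 2 P := by
  have := hW.isGaussianProcess.isProbabilityMeasure
  refine (memLp_congr_ae (h.ae_eq_sum_powerIntegral hm hc hc0 hσ hW t)).2 ?_
  exact (memLp_const A).add (memLp_finsetSum _ fun k _ =>
    (memLp_powerIntegral hc hW t k).const_mul _)

theorem IsCauchySolution.integral_eq (hm : 0 < m) (hc : ContinuousOn c (Ici 0))
    (hc0 : c 0 ≠ 0) (hσ : 0 < σ) (hW : IsBrownianReal W P)
    (h : IsCauchySolution 𝓕 W P m n 0 1 (fun _ => 0) (fun _ => 0) c (fun _ => σ) A B R p)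
    (t : ℝ≥0) :
    P[R t] = A + σ ^ m * ∑ j ∈ Finset.range (m / 2 + 1),
      (m.choose (m - 2 * j) : ℝ) * (ratRoot (B / c 0) m / σ) ^ (m - 2 * j)
        * (((2 * j)! : ℝ) / (2 ^ j * (j ! : ℝ))) * ∫ u in (0 : ℝ)..t, c u * u ^ j := by
  have := hW.isGaussianProcess.isProbabilityMeasure
  have hint (k : ℕ) : Integrable (fun ω => m.choose k * ratRoot (B / c 0) m ^ (m - k) * σ ^ k
      * powerIntegral c W t k ω) P :=
    ((memLp_powerIntegral hc hW t k).integrable one_le_two).const_mul _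
  rw [integral_congr_ae (h.ae_eq_sum_powerIntegral hm hc hc0 hσ hW t),
    integral_add (integrable_const A) (integrable_finsetSum _ fun k _ => hint k),
    integral_finsetSum _ fun k _ => hint k]
  simp only [integral_const_mul, integral_const, probReal_univ, one_smul]
  rw [sum_range_eq_sum_range_of_mod_two m.zero_le fun k hk => by
    rw [integral_powerIntegral_of_odd hc hW t (Nat.odd_iff.2 (by omega)), mul_zero],
    Finset.mul_sum]
  congr 1
  refine Finset.sum_congr rfl fun j hj => ?_
  have hj : 2 * j ≤ m := by have := Finset.mem_range.1 hj; omega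
  have hpow : σ ^ m = σ ^ (m - 2 * j) * σ ^ (2 * j) := by rw [← pow_add, Nat.sub_add_cancel hj]
  rw [add_zero, integral_powerIntegral_two_mul hc hW, Nat.choose_symm hj, hpow, div_pow]
  field_simp

lemma IsCauchySolution.ae_eq_powerIntegral (hm : 0 < m) (hc : ContinuousOn c (Ici 0))
    (hc0 : c 0 ≠ 0) (hσ : 0 < σ) (hW : IsBrownianReal W P)
    (h : IsCauchySolution 𝓕 W P m n 0 1 (fun _ => 0) (fun _ => 0) c (fun _ => σ) A 0 R p)
    (t : ℝ≥0) : R t =ᵐ[P] fun ω => A + σ ^ m * powerIntegral c W t m ω := by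
  filter_upwards [h.ae_eq_integral_pow hm hc hc0 hσ hW t] with ω hω
  simp only [hω, zero_div, ratRoot_zero, zero_add, mul_pow, mul_left_comm (c _),
    intervalIntegral.integral_const_mul, powerIntegral]

theorem IsCauchySolution.integral_eq_meanShift (hm : 0 < m) (hc : ContinuousOn c (Ici 0))
    (hc0 : c 0 ≠ 0) (hσ : 0 < σ) (hW : IsBrownianReal W P)
    (h : IsCauchySolution 𝓕 W P m n 0 1 (fun _ => 0) (fun _ => 0) c (fun _ => σ) A 0 R p)
    (t : ℝ≥0) : P[R t] = A + σ ^ m * meanShift m c t := by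
  have := hW.isGaussianProcess.isProbabilityMeasure
  rw [integral_congr_ae (h.ae_eq_powerIntegral hm hc hc0 hσ hW t), integral_add
    (integrable_const A) (((memLp_powerIntegral hc hW t m).integrable one_le_two).const_mul _)]
  simp [integral_const_mul, integral_powerIntegral_eq_meanShift hc hW]

theorem IsCauchySolution.variance_eq_mixedKernel (hm : 0 < m) (hc : ContinuousOn c (Ici 0))
    (hc0 : c 0 ≠ 0) (hσ : 0 < σ) (hW : IsBrownianReal W P)
    (h : IsCauchySolution 𝓕 W P m n 0 1 (fun _ => 0) (fun _ => 0) c (fun _ => σ) A 0 R p)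
    (t : ℝ≥0) :
    Var[R t; P] = σ ^ (2 * m) *
      ((∫ s in (0 : ℝ)..t, ∫ u in (0 : ℝ)..t, c s * c u * mixedKernel m s u)
        - meanShift m c t ^ 2) := by
  have := hW.isGaussianProcess.isProbabilityMeasure
  have hZ := memLp_powerIntegral hc hW t m
  rw [variance_congr (h.ae_eq_powerIntegral hm hc hc0 hσ hW t), variance_const_add_mul hZ,
    variance_eq_sub hZ, integral_powerIntegral_eq_meanShift hc hW t m,
    ← integral_sq_powerIntegral hc hW t hm, ← pow_mul, mul_comm m 2]
  rfl

/-- The remainder `(R_t - T_t) / σ²` of the first-order Taylor approximation, as a polynomial in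
`σ`. -/
noncomputable def taylorRemainder (m : ℕ) (c : ℝ → ℝ) (c₁ σ : ℝ) (W : ℝ≥0 → Ω → ℝ) (t : ℝ≥0)
    (ω : Ω) : ℝ :=
  ∑ k ∈ Finset.range (m - 1),
    m.choose (k + 2) * c₁ ^ (m - (k + 2)) * σ ^ k * powerIntegral c W t (k + 2) ω

lemma ae_taylorProcess_eq (hc : ContinuousOn c (Ici 0)) (hW : IsBrownianReal W P) (c₁ : ℝ)
    (t : ℝ≥0) :
    (taylorProcess m c A c₁ σ W t : Ω → ℝ) =ᵐ[P]
      fun ω => (A + c₁ ^ m * ∫ u in (0 : ℝ)..t, c u)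
        + m * c₁ ^ (m - 1) * σ * powerIntegral c W t 1 ω := by
  have hc' : ContinuousOn c (uIcc 0 t) := hc.mono (uIcc_of_le t.coe_nonneg ▸ Icc_subset_Ici_self)
  filter_upwards [hW.cont] with ω hWω
  have : Continuous fun u : ℝ => W u.toNNReal ω := hWω.comp continuous_real_toNNReal
  have hconst : IntervalIntegrable (fun u => c₁ ^ m * c u) volume 0 t :=
    ContinuousOn.intervalIntegrable (by fun_prop)
  have hlin : IntervalIntegrable (fun u => m * c₁ ^ (m - 1) * σ * (c u * W u.toNNReal ω)) volume
      0 t := ContinuousOn.intervalIntegrable (by fun_prop)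
  simp only [taylorProcess, powerIntegral, pow_one, ← intervalIntegral.integral_const_mul]
  rw [add_assoc, ← intervalIntegral.integral_add hconst hlin]
  congr with u
  ring

lemma memLp_taylorProcess (hc : ContinuousOn c (Ici 0)) (hW : IsBrownianReal W P) (c₁ : ℝ)
    (t : ℝ≥0) : MemLp (taylorProcess m c A c₁ σ W t) 2 P := by
  have := hW.isGaussianProcess.isProbabilityMeasure
  refine (memLp_congr_ae (ae_taylorProcess_eq hc hW c₁ t)).2 ?_
  exact (memLp_const (A + c₁ ^ m * ∫ u in (0 : ℝ)..t, c u)).add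
    ((memLp_powerIntegral hc hW t 1).const_mul (m * c₁ ^ (m - 1) * σ))

lemma variance_powerIntegral_one (hc : ContinuousOn c (Ici 0)) (hW : IsBrownianReal W P)
    (t : ℝ≥0) :
    Var[powerIntegral c W t 1; P]
      = ∫ s in (0 : ℝ)..t, ∫ u in (0 : ℝ)..t, c s * c u * min s u := by
  rw [variance_of_integral_eq_zero (memLp_powerIntegral hc hW t 1).aemeasurable
    (integral_powerIntegral_of_odd hc hW t odd_one), integral_sq_powerIntegral_one hc hW t]

lemma variance_taylorProcess (hc : ContinuousOn c (Ici 0)) (hW : IsBrownianReal W P) (c₁ : ℝ)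
    (t : ℝ≥0) :
    Var[taylorProcess m c A c₁ σ W t; P] = (m : ℝ) ^ 2 * σ ^ 2 * c₁ ^ (2 * m - 2) *
      ∫ u in (0 : ℝ)..t, ∫ s in (0 : ℝ)..t, c u * c s * min u s := by
  have := hW.isGaussianProcess.isProbabilityMeasure
  rw [variance_congr (ae_taylorProcess_eq hc hW c₁ t),
    variance_const_add_mul (memLp_powerIntegral hc hW t 1), variance_powerIntegral_one hc hW t,
    ← Nat.mul_sub_one, pow_mul']
  ring

lemma covariance_taylorProcess (hc : ContinuousOn c (Ici 0)) (hW : IsBrownianReal W P) (c₁ : ℝ)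
    (t : ℝ≥0) (Y : Ω → ℝ) :
    cov[taylorProcess m c A c₁ σ W t, Y; P]
      = m * c₁ ^ (m - 1) * σ * cov[powerIntegral c W t 1, Y; P] := by
  have := hW.isGaussianProcess.isProbabilityMeasure
  rw [covariance_congr_left (ae_taylorProcess_eq hc hW c₁ t), covariance_const_add_left
    (((memLp_powerIntegral hc hW t 1).integrable one_le_two).const_mul _),
    covariance_const_mul_left]

lemma integral_sq_taylorProcess (hc : ContinuousOn c (Ici 0)) (hW : IsBrownianReal W P) (c₁ : ℝ)
    (t : ℝ≥0) :
    P[fun ω => taylorProcess m c A c₁ σ W t ω ^ 2] =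
      A ^ 2 + 2 * A * c₁ ^ m * (∫ u in (0 : ℝ)..t, c u)
        + c₁ ^ (2 * m) * (∫ u in (0 : ℝ)..t, c u) ^ 2
        + (m : ℝ) ^ 2 * σ ^ 2 * c₁ ^ (2 * m - 2) *
          ∫ u in (0 : ℝ)..t, ∫ s in (0 : ℝ)..t, c u * c s * min u s := by
  have := hW.isGaussianProcess.isProbabilityMeasure
  have hsq : (fun ω => taylorProcess m c A c₁ σ W t ω ^ 2) =ᵐ[P] fun ω =>
      ((A + c₁ ^ m * ∫ u in (0 : ℝ)..t, c u)
        + m * c₁ ^ (m - 1) * σ * powerIntegral c W t 1 ω) ^ 2 := by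
    filter_upwards [ae_taylorProcess_eq hc hW c₁ t] with ω hω
    rw [hω]
  rw [integral_congr_ae hsq, integral_sq_const_add_mul (memLp_powerIntegral hc hW t 1)
    (integral_powerIntegral_of_odd hc hW t odd_one), integral_sq_powerIntegral_one hc hW t]
  rw [← Nat.mul_sub_one, pow_mul', pow_mul']
  ring

lemma IsCauchySolution.ae_eq_taylorProcess_add (hm : 0 < m) (hc : ContinuousOn c (Ici 0))
    (hc0 : c 0 ≠ 0) (hσ : 0 < σ) (hW : IsBrownianReal W P)
    (h : IsCauchySolution 𝓕 W P m n 0 1 (fun _ => 0) (fun _ => 0) c (fun _ => σ) A B R p)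
    (t : ℝ≥0) :
    R t =ᵐ[P] fun ω => taylorProcess m c A (ratRoot (B / c 0) m) σ W t ω
      + σ ^ 2 * taylorRemainder m c (ratRoot (B / c 0) m) σ W t ω := by
  filter_upwards [h.ae_eq_sum_powerIntegral hm hc hc0 hσ hW t,
    ae_taylorProcess_eq (m := m) (A := A) (σ := σ) hc hW (ratRoot (B / c 0) m) t] with ω hR hT
  rw [hR, hT, show m + 1 = (m - 1) + 1 + 1 by omega, Finset.sum_range_succ',
    Finset.sum_range_succ', taylorRemainder, Finset.mul_sum]
  have hsum : ∑ k ∈ Finset.range (m - 1), m.choose (k + 1 + 1)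
        * ratRoot (B / c 0) m ^ (m - (k + 1 + 1)) * σ ^ (k + 1 + 1)
        * powerIntegral c W t (k + 1 + 1) ω
      = ∑ k ∈ Finset.range (m - 1), σ ^ 2 * (m.choose (k + 2)
        * ratRoot (B / c 0) m ^ (m - (k + 2)) * σ ^ k * powerIntegral c W t (k + 2) ω) :=
    Finset.sum_congr rfl fun k _ => by ring
  have hZ0 : powerIntegral c W t 0 ω = ∫ u in (0 : ℝ)..t, c u := by simp [powerIntegral]
  rw [hsum, hZ0]
  simp only [zero_add, Nat.choose_one_right, Nat.choose_zero_right, Nat.cast_one, tsub_zero]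
  ring

section Remainder

variable {c₁ σ₀ : ℝ} {M : ℕ → ℝ} {t : ℝ≥0}

lemma memLp_taylorRemainder (hc : ContinuousOn c (Ici 0)) (hW : IsBrownianReal W P) :
    MemLp (taylorRemainder m c c₁ σ W t) 2 P :=
  memLp_finsetSum _ fun k _ => (memLp_powerIntegral hc hW t (k + 2)).const_mul _

lemma integral_sq_taylorRemainder_le (hc : ContinuousOn c (Ici 0)) (hW : IsBrownianReal W P)
    (hσ : 0 ≤ σ) (hσ₀ : σ ≤ σ₀) (hM : ∀ k, ∫ ω, powerIntegral c W t k ω ^ 2 ∂P ≤ M k) :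
    ∫ ω, taylorRemainder m c c₁ σ W t ω ^ 2 ∂P
      ≤ (m - 1 : ℕ) * ∑ k ∈ Finset.range (m - 1),
          (m.choose (k + 2) * c₁ ^ (m - (k + 2))) ^ 2 * (σ₀ ^ k) ^ 2 * M (k + 2) := by
  refine (integral_sq_sum_le fun k _ =>
    (memLp_powerIntegral hc hW t (k + 2)).const_mul _).trans ?_
  rw [Finset.card_range]
  gcongr with k
  simp only [mul_pow, integral_const_mul]
  gcongr
  exact hM _

-- The `k = 0` term of the remainder is orthogonal to the linear term by parity, whence the factor
-- `σ`; the truncated exponent `k - 1` is harmless there.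
lemma abs_covariance_taylorRemainder_le (hc : ContinuousOn c (Ici 0)) (hW : IsBrownianReal W P)
    (hσ : 0 ≤ σ) (hσ₀ : σ ≤ σ₀) (hM : ∀ k, ∫ ω, powerIntegral c W t k ω ^ 2 ∂P ≤ M k) :
    |cov[powerIntegral c W t 1, taylorRemainder m c c₁ σ W t; P]|
      ≤ σ * ∑ k ∈ Finset.range (m - 1), |m.choose (k + 2) * c₁ ^ (m - (k + 2))|
          * (σ₀ ^ (k - 1) * ((M 1 + M (k + 2)) / 2)) := by
  have := hW.isGaussianProcess.isProbabilityMeasure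
  have hZ := memLp_powerIntegral hc hW t
  have hvar (k : ℕ) : Var[powerIntegral c W t k; P] ≤ M k :=
    (variance_le_expectation_sq (hZ k).aestronglyMeasurable).trans (hM k)
  have hcov (k : ℕ) : σ ^ k * |cov[powerIntegral c W t 1, powerIntegral c W t (k + 2); P]|
      ≤ σ * (σ₀ ^ (k - 1) * ((M 1 + M (k + 2)) / 2)) := by
    have hbound : |cov[powerIntegral c W t 1, powerIntegral c W t (k + 2); P]|
        ≤ (M 1 + M (k + 2)) / 2 :=
      (abs_covariance_le (hZ 1) (hZ (k + 2))).trans (by linarith [hvar 1, hvar (k + 2)])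
    have hM0 := (abs_nonneg _).trans hbound
    rcases k with - | k
    · have hodd : cov[powerIntegral c W t 1, powerIntegral c W t (0 + 2); P] = 0 := by
        rw [covariance_eq_sub (hZ 1) (hZ _), integral_powerIntegral_of_odd hc hW t odd_one]
        simp [integral_powerIntegral_mul_of_odd hc hW t (show Odd (1 + 2) by decide)]
      rw [hodd, abs_zero, mul_zero]
      exact mul_nonneg hσ (mul_nonneg (pow_nonneg (hσ.trans hσ₀) _) hM0)
    · have hσ₀0 : 0 ≤ σ₀ := hσ.trans hσ₀
      rw [pow_succ', mul_assoc, Nat.add_sub_cancel]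
      gcongr
  unfold taylorRemainder
  rw [covariance_fun_sum_right' (fun k _ => (hZ (k + 2)).const_mul _) (hZ 1), Finset.mul_sum]
  refine (Finset.abs_sum_le_sum_abs _ _).trans (Finset.sum_le_sum fun k _ => ?_)
  rw [covariance_const_mul_right, abs_mul, abs_mul _ (σ ^ k), abs_of_nonneg (pow_nonneg hσ k),
    mul_assoc, mul_left_comm σ]
  exact mul_le_mul_of_nonneg_left (hcov k) (abs_nonneg _)

end Remainder

theorem exists_taylorProcess_bound (hm : 0 < m) (hc : ContinuousOn c (Ici 0))
    (hc0 : c 0 ≠ 0) (B σ₀ T : ℝ) :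
    ∃ K : ℝ, ∀ {Ω : Type v} {mΩ : MeasurableSpace Ω} {P : Measure Ω} {𝓕 : Filtration ℝ≥0 mΩ}
      {W R p : ℝ≥0 → Ω → ℝ} {n : ℚ} {σ A : ℝ}, 0 < σ → σ ≤ σ₀ → IsBrownianReal W P →
      IsCauchySolution 𝓕 W P m n 0 1 (fun _ => 0) (fun _ => 0) c (fun _ => σ) A B R p →
      ∀ t : ℝ≥0, t ≤ T →
        P[fun ω => (R t ω - taylorProcess m c A (ratRoot (B / c 0) m) σ W t ω) ^ 2] ≤ K * σ ^ 4 ∧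
        |Var[R t; P] - Var[taylorProcess m c A (ratRoot (B / c 0) m) σ W t; P]| ≤ K * σ ^ 4 := by
  set c₁ := ratRoot (B / c 0) m
  let M (k : ℕ) : ℝ := T * ∫ u in (0 : ℝ)..T, c u ^ 2 * gaussianMoment u (2 * k)
  let K₁ : ℝ := (m - 1 : ℕ) * ∑ k ∈ Finset.range (m - 1),
    (m.choose (k + 2) * c₁ ^ (m - (k + 2))) ^ 2 * (σ₀ ^ k) ^ 2 * M (k + 2)
  let K₂ : ℝ := ∑ k ∈ Finset.range (m - 1), |m.choose (k + 2) * c₁ ^ (m - (k + 2))|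
    * (σ₀ ^ (k - 1) * ((M 1 + M (k + 2)) / 2))
  refine ⟨K₁ + 2 * |m * c₁ ^ (m - 1)| * |K₂|, fun {Ω mΩ P 𝓕 W R p n σ A} hσ hσ₀ hW h t ht => ?_⟩
  have := hW.isGaussianProcess.isProbabilityMeasure
  have hM (k : ℕ) : ∫ ω, powerIntegral c W t k ω ^ 2 ∂P ≤ M k :=
    integral_sq_powerIntegral_le hc hW ht k
  set X := taylorProcess m c A c₁ σ W t
  set D := taylorRemainder m c c₁ σ W t
  have hD2 : ∫ ω, D ω ^ 2 ∂P ≤ K₁ := integral_sq_taylorRemainder_le hc hW hσ.le hσ₀ hM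
  have hcov : |cov[X, D; P]| ≤ |m * c₁ ^ (m - 1)| * σ * (σ * |K₂|) := by
    rw [covariance_taylorProcess hc hW, abs_mul, abs_mul _ σ, abs_of_pos hσ]
    gcongr
    exact (abs_covariance_taylorRemainder_le hc hW hσ.le hσ₀ hM).trans
      (mul_le_mul_of_nonneg_left (le_abs_self K₂) hσ.le)
  have hR : R t =ᵐ[P] fun ω => X ω + σ ^ 2 * D ω := h.ae_eq_taylorProcess_add hm hc hc0 hσ hW t
  constructor
  · have hsq : (fun ω => (R t ω - X ω) ^ 2) =ᵐ[P] fun ω => σ ^ 4 * D ω ^ 2 := by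
      filter_upwards [hR] with ω hω
      rw [hω]
      ring
    rw [integral_congr_ae hsq, integral_const_mul, mul_comm]
    gcongr
    exact hD2.trans (le_add_of_nonneg_right (by positivity))
  · rw [variance_congr hR]
    calc |Var[fun ω => X ω + σ ^ 2 * D ω; P] - Var[X; P]|
        ≤ 2 * |σ ^ 2| * |cov[X, D; P]| + (σ ^ 2) ^ 2 * ∫ ω, D ω ^ 2 ∂P :=
          abs_variance_add_mul_sub_le (memLp_taylorProcess hc hW c₁ t)
            (memLp_taylorRemainder hc hW) _
      _ ≤ 2 * |σ ^ 2| * (|m * c₁ ^ (m - 1)| * σ * (σ * |K₂|)) + (σ ^ 2) ^ 2 * K₁ := by gcongr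
      _ = (K₁ + 2 * |m * c₁ ^ (m - 1)| * |K₂|) * σ ^ 4 := by
          rw [abs_of_nonneg (sq_nonneg σ)]
          ring

end ConstantCoefficients

end InterestRate

theorem lemma1 (c : ℝ → ℝ) (hc : ContinuousOn c (Ici 0)) (hc0 : c 0 ≠ 0) (B : ℝ) :
    -- pathwise formula
    (∀ (m : ℚ), 0 < m → ∀ (n : ℚ) (a σ : ℝ → ℝ) (A : ℝ),
      ContinuousOn a (Ici 0) → ContDiffOn ℝ 1 σ (Ici 0) → (∀ t, 0 ≤ t → 0 < σ t) →
      ∀ (Ω : Type v) (mΩ : MeasurableSpace Ω) (P : Measure Ω) (𝓕 : Filtration ℝ≥0 mΩ)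
        (W R p : ℝ≥0 → Ω → ℝ), IsWiener 𝓕 W P →
        IsCauchySolution 𝓕 W P m n 0 1 a (fun _ => 0) c σ A B R p →
        ∀ᵐ ω ∂P, ∀ t : ℝ≥0, R t ω = explicitSolution m a c σ A B (fun s => W s ω) t) ∧
    -- mean and variance for `B = 0`
    (B = 0 → ∀ (m : ℕ), 0 < m → ∀ (n : ℚ) (σ A : ℝ), 0 < σ →
      ∀ (Ω : Type v) (mΩ : MeasurableSpace Ω) (P : Measure Ω) (𝓕 : Filtration ℝ≥0 mΩ)
        (W R p : ℝ≥0 → Ω → ℝ), IsWiener 𝓕 W P →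
        IsCauchySolution 𝓕 W P m n 0 1 (fun _ => 0) (fun _ => 0) c (fun _ => σ) A B R p →
        ∀ t : ℝ≥0, MemLp (R t) 2 P ∧
          P[R t] = (if Even m then A + σ ^ m * meanShift m c t else A) ∧
          Var[R t; P] = σ ^ (2 * m) *
            ((∫ s in (0 : ℝ)..t, ∫ u in (0 : ℝ)..t, c s * c u * mixedKernel m s u)
              - meanShift m c t ^ 2)) ∧
    -- mean for `B ≠ 0`
    (B ≠ 0 → ∀ (m : ℕ), 0 < m → ∀ (n : ℚ) (σ A : ℝ), 0 < σ →
      ∀ (Ω : Type v) (mΩ : MeasurableSpace Ω) (P : Measure Ω) (𝓕 : Filtration ℝ≥0 mΩ)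
        (W R p : ℝ≥0 → Ω → ℝ), IsWiener 𝓕 W P →
        IsCauchySolution 𝓕 W P m n 0 1 (fun _ => 0) (fun _ => 0) c (fun _ => σ) A B R p →
        ∀ t : ℝ≥0, Integrable (R t) P ∧
          P[R t] = A + σ ^ m * ∑ j ∈ Finset.range (m / 2 + 1),
            (m.choose (m - 2 * j) : ℝ) * (ratRoot (B / c 0) m / σ) ^ (m - 2 * j)
              * (((2 * j)! : ℝ) / (2 ^ j * (j ! : ℝ))) * ∫ u in (0 : ℝ)..t, c u * u ^ j) ∧
    -- Taylor approximation of the variance for `B ≠ 0`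
    (B ≠ 0 → ∀ (m : ℕ), 0 < m → ∀ σ₀ T : ℝ, ∃ K : ℝ, ∀ (n : ℚ) (σ A : ℝ), 0 < σ → σ ≤ σ₀ →
      ∀ (Ω : Type v) (mΩ : MeasurableSpace Ω) (P : Measure Ω) (𝓕 : Filtration ℝ≥0 mΩ)
        (W R p : ℝ≥0 → Ω → ℝ), IsWiener 𝓕 W P →
        IsCauchySolution 𝓕 W P m n 0 1 (fun _ => 0) (fun _ => 0) c (fun _ => σ) A B R p →
        ∀ (c₁ : ℝ), c₁ = ratRoot (B / c 0) m → ∀ t : ℝ≥0, (t : ℝ) ≤ T →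
          MemLp (R t) 2 P ∧ MemLp (taylorProcess m c A c₁ σ W t) 2 P ∧
          P[fun ω => (R t ω - taylorProcess m c A c₁ σ W t ω) ^ 2] ≤ K * σ ^ 4 ∧
          P[fun ω => taylorProcess m c A c₁ σ W t ω ^ 2] =
            A ^ 2 + 2 * A * c₁ ^ m * (∫ u in (0 : ℝ)..t, c u)
              + c₁ ^ (2 * m) * (∫ u in (0 : ℝ)..t, c u) ^ 2
              + (m : ℝ) ^ 2 * σ ^ 2 * c₁ ^ (2 * m - 2) *
                ∫ u in (0 : ℝ)..t, ∫ s in (0 : ℝ)..t, c u * c s * min u s ∧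
          Var[taylorProcess m c A c₁ σ W t; P] = (m : ℝ) ^ 2 * σ ^ 2 * c₁ ^ (2 * m - 2) *
            ∫ u in (0 : ℝ)..t, ∫ s in (0 : ℝ)..t, c u * c s * min u s ∧
          |Var[R t; P] - (m : ℝ) ^ 2 * σ ^ 2 * c₁ ^ (2 * m - 2) *
            ∫ u in (0 : ℝ)..t, ∫ s in (0 : ℝ)..t, c u * c s * min u s| ≤ K * σ ^ 4) := by
  refine ⟨fun m hm n a σ A ha hσ hσ0 Ω mΩ P 𝓕 W R p hW h =>
      h.eq_explicitSolution hm hc hc0 ha hσ hσ0 hW.brownian, ?_, ?_, ?_⟩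
  · rintro rfl m hm n σ A hσ Ω mΩ P 𝓕 W R p hW h t
    refine ⟨h.memLp_two hm hc hc0 hσ hW.brownian t, ?_,
      h.variance_eq_mixedKernel hm hc hc0 hσ hW.brownian t⟩
    rw [h.integral_eq_meanShift hm hc hc0 hσ hW.brownian t]
    split_ifs with hm2
    · rfl
    · rw [meanShift, if_neg hm2, mul_zero, add_zero]
  · intro _ m hm n σ A hσ Ω mΩ P 𝓕 W R p hW h t
    have := hW.brownian.isGaussianProcess.isProbabilityMeasure
    exact ⟨(h.memLp_two hm hc hc0 hσ hW.brownian t).integrable one_le_two,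
      h.integral_eq hm hc hc0 hσ hW.brownian t⟩
  · intro _ m hm σ₀ T
    obtain ⟨K, hK⟩ := exists_taylorProcess_bound hm hc hc0 B σ₀ T
    refine ⟨K, ?_⟩
    rintro n σ A hσ hσ₀ Ω mΩ P 𝓕 W R p hW h c₁ rfl t ht
    have hvar := variance_taylorProcess (m := m) (A := A) (σ := σ) hc hW.brownian
      (ratRoot (B / c 0) m) t
    obtain ⟨hmse, hdiff⟩ := hK hσ hσ₀ hW.brownian h t ht
    exact ⟨h.memLp_two hm hc hc0 hσ hW.brownian t, memLp_taylorProcess hc hW.brownian _ t,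
      hmse, integral_sq_taylorProcess hc hW.brownian _ t, hvar, hvar ▸ hdiff⟩
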